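/- Let $A$ be a unital $C^*$-algebra and let $M$ be a correspondence over $A$, i.e. a right Hilbert $A$-module with a left action of $A$ given by a $*$-homomorphism of $A$ into the adjointable operators on $M$; assume that $M$ is essential: $1\cdot n=n$ for all $n\in M$. For a Hilbert $A$-module $X$, $X\otimes_A M$ denotes the internal tensor product, the completion of the algebraic tensor product for $\langle x\otimes n,y\otimes p\rangle=\langle n,\langle x,y\rangle\cdot p\rangle$. If $T:X\to Y$ preserves inner products, $T\otimes\mathrm{id}:X\otimes_AM\to Y\otimes_AM$ is the inner-product preserving map with $(T\otimes\mathrm{id})(x\otimes n)=Tx\otimes n$. Put $M^{\otimes 0}=A$ and $M^{\otimes(k+1)}=M^{\otimes k}\otimes_A M$ (so $M^{\otimes 1}=A\otimes_AM\cong M$ through $a\otimes n\mapsto a\cdot n$). Let $m\in M$ be a filter, i.e. $\langle m,m\rangle=1$. Let $T_k:M^{\otimes k}\to M^{\otimes (k+1)}$ be the inner-product preserving maps $T_k(n)=m\otimes n$ (that is, $T_0(a)=m\cdot a$ and $T_{k+1}=T_k\otimes\mathrm{id}$), and let $(M_\infty,\iota^k)=\varinjlim(M^{\otimes k},T_k)$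 be the direct limit of Hilbert $A$-modules, with its canonical inner-product preserving maps $\iota^k:M^{\otimes k}\to M_\infty$, which satisfy $\iota^{k+1}\circ T_k=\iota^k$. Let $(X,D,\phi)$ be a scaling function for $m$: $X$ is a Hilbert $A$-module, $D:X\to X\otimes_AM$ is an isomorphism of Hilbert $A$-modules, and $\phi\in X$ satisfies $\langle\phi,\phi\rangle=1$ and $D\phi=\phi\otimes m$. Let $D^k:X\to X\otimes_AM^{\otimes k}$ be the isomorphisms given by $D^0=\mathrm{id}$ and $D^{k+1}=(D^k\otimes\mathrm{id})\circ D$. Then there is an isomorphism of Hilbert $A$-modules $R:M_\infty\to M_\infty\otimes_AM$ such that $R\circ\iota^{k+1}=\iota^k\otimes\mathrm{id}$ for all $k\ge 0$, and there is an inner-product preserving map $Q:M_\infty\to X$ such that $Q(\iota^0(1))=\phi$ and $D\circ Q=(Q\otimes\mathrm{id})\circ R$. The submodules $V_k:=Q(\iota^k(M^{\otimes k}))$, $k\ge0$, form a projective multi-resolution analysis for the submodule $W:=Q(M_\infty)$ of $X$. This means the following: $W$ is closed and $D$ restricts to an isomorphism of $W$ onto $W\otimes_AM\subseteq X\otimes_AM$;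 every $V_k$ is contained in $W$; and (i) $V_0$ is a complemented submodule of $W$ (it is closed, and every $x\in W$ is a sum $v+w$ with $v\in V_0$ and $w\in W$ orthogonal to $V_0$); (ii) $V_k=(D^k)^{-1}(V_0\otimes_AM^{\otimes k})$ for all $k\ge0$, where $V_0\otimes_AM^{\otimes k}$ is regarded as a closed submodule of $X\otimes_AM^{\otimes k}$; (iii) $V_k$ is a complemented submodule of $V_{k+1}$ for all $k\ge0$; (iv) $\bigcup_{k}V_k$ is dense in $W$. Moreover, $V_0$ is the free rank-one $A$-module generated by $\phi$: $V_0=\{\phi\cdot a: a\in A\}$, and $a\mapsto\phi\cdot a$ is injective. -/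

import Mathlib

open scoped TensorProduct
open MulOpposite

universe u

/-- An `A`-valued pre-inner product on a complex vector space `E` carrying a compatible right action
of the `C⋆`-algebra `A` (written, as usual in Mathlib, as an action of `Aᵐᵒᵖ`, so `x · a` is
`op a • x`). It is `A`-linear in the second variable, and vectors of length zero are allowed. -/
structure PreInner (A : Type u) [CStarAlgebra A] [PartialOrder A] [StarOrderedRing A]
    (E : Type u) [AddCommGroup E] [Module ℂ E] [Module Aᵐᵒᵖ E] [IsScalarTower ℂ Aᵐᵒᵖ E] where
  inner : E → E → A
  inner_add_right : ∀ x y z, inner x (y + z) = inner x y + inner x z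
  inner_op_smul_right : ∀ (x y) (a : A), inner x (op a • y) = inner x y * a
  star_inner : ∀ x y, star (inner x y) = inner y x
  inner_self_nonneg : ∀ x, 0 ≤ inner x x

namespace PreInner

variable {A : Type u} [CStarAlgebra A] [PartialOrder A] [StarOrderedRing A]
  {E : Type u} [AddCommGroup E] [Module ℂ E] [Module Aᵐᵒᵖ E] [IsScalarTower ℂ Aᵐᵒᵖ E]
  {F : Type u} [AddCommGroup F] [Module ℂ F] [Module Aᵐᵒᵖ F] [IsScalarTower ℂ Aᵐᵒᵖ F]

theorem complex_smul (z : ℂ) (x : E) : z • x = op (algebraMap ℂ A z) • x := by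
  have h : (op (algebraMap ℂ A z) : Aᵐᵒᵖ) = z • (1 : Aᵐᵒᵖ) := by
    rw [Algebra.algebraMap_eq_smul_one]; rfl
  rw [h, smul_assoc, one_smul]

variable (S : PreInner A E)

theorem inner_add_left (x y z : E) : S.inner (x + y) z = S.inner x z + S.inner y z := by
  rw [← S.star_inner, S.inner_add_right, star_add, S.star_inner, S.star_inner]

theorem inner_op_smul_left (x y : E) (a : A) :
    S.inner (op a • x) y = star a * S.inner x y := by
  rw [← S.star_inner, S.inner_op_smul_right, star_mul, S.star_inner]

theorem inner_smul_right (x y : E) (z : ℂ) : S.inner x (z • y) = z • S.inner x y := by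
  rw [complex_smul (A := A), S.inner_op_smul_right, Algebra.algebraMap_eq_smul_one, mul_smul_comm,
    mul_one]

theorem inner_smul_left (x y : E) (z : ℂ) : S.inner (z • x) y = star z • S.inner x y := by
  rw [← S.star_inner, S.inner_smul_right, star_smul, S.star_inner]

/-- The pre-inner product as a sesquilinear map. -/
noncomputable def innerₛₗ : E →ₗ⋆[ℂ] E →ₗ[ℂ] A :=
  LinearMap.mk₂'ₛₗ _ _ S.inner S.inner_add_left (fun c x y => S.inner_smul_left x y c)
    S.inner_add_right (fun c x y => S.inner_smul_right x y c)

theorem innerₛₗ_apply (x y : E) : S.innerₛₗ x y = S.inner x y := rfl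

theorem inner_zero_right (x : E) : S.inner x 0 = 0 := (S.innerₛₗ x).map_zero

theorem inner_zero_left (x : E) : S.inner 0 x = 0 := by
  rw [← innerₛₗ_apply, map_zero, LinearMap.zero_apply]

theorem inner_sub_right (x y z : E) : S.inner x (y - z) = S.inner x y - S.inner x z :=
  (S.innerₛₗ x).map_sub y z

theorem inner_sub_left (x y z : E) : S.inner (x - y) z = S.inner x z - S.inner y z := by
  rw [← S.star_inner, S.inner_sub_right, star_sub, S.star_inner, S.star_inner]

theorem norm_inner_sq_le (x y : E) :
    ‖S.inner x y‖ ^ 2 ≤ ‖S.inner x x‖ * ‖S.inner y y‖ := by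
  have key : ∀ c : ℝ, ‖S.inner x x‖ < c → ‖S.inner x y‖ ^ 2 ≤ c * ‖S.inner y y‖ := by
    intro c hc
    have hc0 : 0 < c := (norm_nonneg _).trans_lt hc
    set a := S.inner x y with ha
    have h1 : 0 ≤ S.inner (op a • x - (c : ℂ) • y) (op a • x - (c : ℂ) • y) :=
      S.inner_self_nonneg _
    have h2 : S.inner (op a • x - (c : ℂ) • y) (op a • x - (c : ℂ) • y)
        = star a * S.inner x x * a - c • (star a * a) - c • (star a * a)
          + c • c • S.inner y y := by
      have hyx : S.inner y x = star a := by rw [ha, S.star_inner]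
      rw [S.inner_sub_right, S.inner_sub_left, S.inner_sub_left, S.inner_op_smul_right,
        S.inner_op_smul_right, S.inner_op_smul_left, S.inner_op_smul_left, S.inner_smul_left,
        S.inner_smul_left, S.inner_smul_right, S.inner_smul_right, hyx, ← ha, Complex.star_def,
        Complex.conj_ofReal, Complex.coe_smul, Complex.coe_smul, Complex.coe_smul,
        smul_mul_assoc, mul_smul_comm]
      simp only [Complex.coe_smul]
      abel
    have h3 : star a * S.inner x x * a ≤ c • (star a * a) :=
      (CStarAlgebra.star_left_conjugate_le_norm_smul (a := a) (b := S.inner x x)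
        (hb := IsSelfAdjoint.of_nonneg (S.inner_self_nonneg x))).trans
        (smul_le_smul_of_nonneg_right hc.le (star_mul_self_nonneg a))
    have h4 : c • (star a * a) ≤ c • c • S.inner y y := by
      have := h1.trans_eq h2
      have h5 : 0 ≤ c • (star a * a) - c • (star a * a) - c • (star a * a)
          + c • c • S.inner y y := by
        refine this.trans ?_
        gcongr
      simpa [add_comm, ← sub_eq_add_neg, sub_nonneg] using h5
    have h5 : star a * a ≤ c • S.inner y y := (smul_le_smul_iff_of_pos_left hc0).1 h4
    have h6 := CStarAlgebra.norm_le_norm_of_nonneg_of_le (star_mul_self_nonneg a) h5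
    rw [CStarRing.norm_star_mul_self, norm_smul, Real.norm_of_nonneg hc0.le] at h6
    rwa [sq]
  have hT : Filter.Tendsto (fun c : ℝ => c * ‖S.inner y y‖) (nhdsWithin ‖S.inner x x‖
      (Set.Ioi ‖S.inner x x‖)) (nhds (‖S.inner x x‖ * ‖S.inner y y‖)) :=
    ((continuous_id.mul continuous_const).tendsto _).mono_left nhdsWithin_le_nhds
  exact ge_of_tendsto hT (Filter.eventually_of_mem self_mem_nhdsWithin fun c hc => key c hc)

/-- The vector space `E` regarded as a seminormed space, with `‖x‖ = ‖⟨x, x⟩‖ ^ (1/2)`. -/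
@[nolint unusedArguments]
def Space (_ : PreInner A E) : Type u := E

namespace Space

instance : AddCommGroup S.Space := inferInstanceAs (AddCommGroup E)
instance : Module ℂ S.Space := inferInstanceAs (Module ℂ E)
instance : Module Aᵐᵒᵖ S.Space := inferInstanceAs (Module Aᵐᵒᵖ E)
instance : IsScalarTower ℂ Aᵐᵒᵖ S.Space := inferInstanceAs (IsScalarTower ℂ Aᵐᵒᵖ E)

/-- The pre-inner product, on `S.Space`. -/
def form : PreInner A S.Space := S

noncomputable instance : Norm S.Space := ⟨fun x => √‖(form S).inner x x‖⟩

theorem norm_def (x : S.Space) : ‖x‖ = √‖(form S).inner x x‖ := rfl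

theorem norm_sq (x : S.Space) : ‖x‖ ^ 2 = ‖(form S).inner x x‖ := Real.sq_sqrt (norm_nonneg _)

theorem norm_inner_le (x y : S.Space) : ‖(form S).inner x y‖ ≤ ‖x‖ * ‖y‖ := by
  refine le_of_sq_le_sq ?_ (mul_nonneg (Real.sqrt_nonneg _) (Real.sqrt_nonneg _))
  rw [mul_pow, norm_sq, norm_sq]
  exact (form S).norm_inner_sq_le x y

theorem core : SeminormedSpace.Core ℂ S.Space where
  norm_nonneg x := Real.sqrt_nonneg _
  norm_smul c x := by
    change √‖(form S).inner (c • x) (c • x)‖ = ‖c‖ * √‖(form S).inner x x‖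
    rw [(form S).inner_smul_left, (form S).inner_smul_right, norm_smul, norm_smul, ← mul_assoc, norm_star,
      ← sq, Real.sqrt_mul (sq_nonneg _), Real.sqrt_sq (norm_nonneg _)]
  norm_triangle x y := by
    have hn : ∀ z : S.Space, 0 ≤ ‖z‖ := fun z => Real.sqrt_nonneg _
    refine le_of_sq_le_sq ?_ (add_nonneg (hn x) (hn y))
    rw [norm_sq]
    change ‖(form S).inner (x + y) (x + y)‖ ≤ _
    rw [(form S).inner_add_left, (form S).inner_add_right, (form S).inner_add_right]
    calc _ ≤ ‖(form S).inner x x‖ + ‖(form S).inner x y‖ + (‖(form S).inner y x‖ + ‖(form S).inner y y‖) :=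
          (norm_add_le _ _).trans (add_le_add (norm_add_le _ _) (norm_add_le _ _))
      _ ≤ ‖x‖ ^ 2 + ‖x‖ * ‖y‖ + (‖y‖ * ‖x‖ + ‖y‖ ^ 2) := by
          rw [norm_sq, norm_sq]
          gcongr
          · exact norm_inner_le S x y
          · exact norm_inner_le S y x
      _ = _ := by ring

noncomputable instance : SeminormedAddCommGroup S.Space := .ofCore (core S)

noncomputable instance : NormedSpace ℂ S.Space where
  norm_smul_le c x := ((core S).norm_smul c x).le

theorem norm_op_smul_le (a : Aᵐᵒᵖ) (x : S.Space) : ‖a • x‖ ≤ ‖a‖ * ‖x‖ := by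
  refine le_of_sq_le_sq ?_ (by positivity)
  rw [mul_pow, norm_sq, norm_sq]
  change ‖(form S).inner (op a.unop • x) (op a.unop • x)‖ ≤ _
  rw [(form S).inner_op_smul_left, (form S).inner_op_smul_right]
  calc _ ≤ ‖star a.unop‖ * (‖(form S).inner x x‖ * ‖a.unop‖) :=
        (norm_mul_le _ _).trans (by gcongr; exact norm_mul_le _ _)
    _ = _ := by rw [norm_star, MulOpposite.norm_unop]; ring

instance : UniformContinuousConstSMul Aᵐᵒᵖ S.Space where
  uniformContinuous_const_smul a :=
    (AddMonoidHomClass.lipschitz_of_bound (DistribSMul.toAddMonoidHom S.Space a) ‖a‖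
      (norm_op_smul_le S a)).uniformContinuous

theorem continuous_inner : Continuous fun p : S.Space × S.Space => (form S).inner p.1 p.2 := by
  let B : S.Space →L⋆[ℂ] S.Space →L[ℂ] A :=
    LinearMap.mkContinuous₂ ((form S).innerₛₗ : S.Space →ₗ⋆[ℂ] S.Space →ₗ[ℂ] A) 1
      (fun x y => by rw [one_mul]; exact norm_inner_le S x y)
  exact (B.continuous.comp continuous_fst).clm_apply continuous_snd

end Space

end PreInner

/-- A right Hilbert module over the `C⋆`-algebra `A`: a complex Banach space with a right
`A`-action (as an action of `Aᵐᵒᵖ`) and an `A`-valued inner product, linear in the second variable,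
such that `‖x‖² = ‖⟨x, x⟩‖`; definiteness is part of the norm axioms. (Mathlib's `CStarModule A E`
is the mirror image of this notion: its inner product is linear for a left action of `A`.) -/
structure HilbertModule (A : Type u) [CStarAlgebra A] [PartialOrder A] [StarOrderedRing A] where
  carrier : Type u
  [normedAddCommGroup : NormedAddCommGroup carrier]
  [normedSpace : NormedSpace ℂ carrier]
  [module : Module Aᵐᵒᵖ carrier]
  [isScalarTower : IsScalarTower ℂ Aᵐᵒᵖ carrier]
  [completeSpace : CompleteSpace carrier]
  form : PreInner A carrier
  norm_sq : ∀ x, ‖x‖ ^ 2 = ‖form.inner x x‖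

attribute [instance] HilbertModule.normedAddCommGroup HilbertModule.normedSpace
  HilbertModule.module HilbertModule.isScalarTower HilbertModule.completeSpace

instance {A : Type u} [CStarAlgebra A] [PartialOrder A] [StarOrderedRing A] :
    CoeSort (HilbertModule A) (Type u) := ⟨HilbertModule.carrier⟩

/-- `⟪x, y⟫` is the `A`-valued inner product of a Hilbert `A`-module. -/
def HilbertModule.inner {A : Type u} [CStarAlgebra A] [PartialOrder A] [StarOrderedRing A]
    {X : HilbertModule A} (x y : X) : A := X.form.inner x y

local notation "⟪" x ", " y "⟫" => HilbertModule.inner x y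

/-- An inner-product preserving map between Hilbert `A`-modules (not necessarily adjointable). -/
structure InnerMap {A : Type u} [CStarAlgebra A] [PartialOrder A] [StarOrderedRing A]
    (X Y : HilbertModule A) extends X →ₗ[Aᵐᵒᵖ] Y where
  inner_map : ∀ x y, ⟪toFun x, toFun y⟫ = ⟪x, y⟫

/-- An isomorphism of Hilbert `A`-modules. -/
structure HilbertModuleIso {A : Type u} [CStarAlgebra A] [PartialOrder A] [StarOrderedRing A]
    (X Y : HilbertModule A) extends X ≃ₗ[Aᵐᵒᵖ] Y where
  inner_map : ∀ x y, ⟪toFun x, toFun y⟫ = ⟪x, y⟫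

section

variable {A : Type u} [CStarAlgebra A] [PartialOrder A] [StarOrderedRing A]

namespace InnerMap

variable {X Y Z : HilbertModule A}

instance : FunLike (InnerMap X Y) X Y where
  coe T := T.toFun
  coe_injective S T h := by
    cases S; cases T; congr; exact DFunLike.coe_injective h

instance : AddMonoidHomClass (InnerMap X Y) X Y where
  map_add T := T.map_add'
  map_zero T := T.toLinearMap.map_zero

theorem map_op_smul (T : InnerMap X Y) (a : Aᵐᵒᵖ) (x : X) : T (a • x) = a • T x :=
  T.toLinearMap.map_smul a x

theorem inner_apply (T : InnerMap X Y) (x y : X) : ⟪T x, T y⟫ = ⟪x, y⟫ := T.inner_map x y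

theorem map_smul (T : InnerMap X Y) (c : ℂ) (x : X) : T (c • x) = c • T x := by
  rw [PreInner.complex_smul (A := A), PreInner.complex_smul (A := A), T.map_op_smul]

/-- The identity map. -/
def id (X : HilbertModule A) : InnerMap X X := ⟨LinearMap.id, fun _ _ => rfl⟩

/-- Composition. -/
def comp (S : InnerMap Y Z) (T : InnerMap X Y) : InnerMap X Z :=
  ⟨S.toLinearMap ∘ₗ T.toLinearMap, fun x y => (S.inner_map _ _).trans (T.inner_map x y)⟩

end InnerMap

namespace HilbertModuleIso

variable {X Y : HilbertModule A}

/-- A Hilbert module isomorphism as an inner-product preserving map. -/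
def toInnerMap (U : HilbertModuleIso X Y) : InnerMap X Y :=
  ⟨U.toLinearEquiv.toLinearMap, U.inner_map⟩

instance : FunLike (HilbertModuleIso X Y) X Y where
  coe T := T.toFun
  coe_injective S T h := by
    cases S; cases T; congr; exact DFunLike.coe_injective h

end HilbertModuleIso

theorem HilbertModule.continuous_inner (X : HilbertModule A) :
    Continuous fun p : X × X => ⟪p.1, p.2⟫ := by
  let B : X →L⋆[ℂ] X →L[ℂ] A :=
    LinearMap.mkContinuous₂ X.form.innerₛₗ 1 (fun x y => by
      rw [one_mul]
      refine le_of_sq_le_sq ?_ (by positivity)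
      rw [mul_pow, X.norm_sq, X.norm_sq]
      exact X.form.norm_inner_sq_le x y)
  exact (B.continuous.comp continuous_fst).clm_apply continuous_snd

theorem HilbertModule.norm_op_smul_le {X : HilbertModule A} (a : Aᵐᵒᵖ) (x : X) :
    ‖a • x‖ ≤ ‖a‖ * ‖x‖ := by
  refine le_of_sq_le_sq ?_ (by positivity)
  rw [mul_pow, X.norm_sq, X.norm_sq]
  change ‖X.form.inner (op a.unop • x) (op a.unop • x)‖ ≤ _
  rw [X.form.inner_op_smul_left, X.form.inner_op_smul_right]
  calc _ ≤ ‖star a.unop‖ * (‖X.form.inner x x‖ * ‖a.unop‖) :=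
        (norm_mul_le _ _).trans (by gcongr; exact norm_mul_le _ _)
    _ = _ := by rw [norm_star, MulOpposite.norm_unop]; ring

instance (X : HilbertModule A) : ContinuousConstSMul Aᵐᵒᵖ X where
  continuous_const_smul a :=
    (AddMonoidHomClass.lipschitz_of_bound (DistribSMul.toAddMonoidHom X a) ‖a‖
      (HilbertModule.norm_op_smul_le a)).continuous

/-! ### Completion -/

namespace PreInner

open UniformSpace

variable {E : Type u} [AddCommGroup E] [Module ℂ E] [Module Aᵐᵒᵖ E] [IsScalarTower ℂ Aᵐᵒᵖ E]
  (S : PreInner A E)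

/-- The continuous extension of the pre-inner product to the completion. -/
noncomputable def innerC (x y : Completion S.Space) : A :=
  (Completion.isDenseInducing_coe.prodMap Completion.isDenseInducing_coe).extend
    (fun p : S.Space × S.Space => (Space.form S).inner p.1 p.2) (x, y)

theorem innerC_coe (x y : S.Space) :
    S.innerC (x : Completion S.Space) (y : Completion S.Space) = (Space.form S).inner x y :=
  (Completion.isDenseInducing_coe.prodMap Completion.isDenseInducing_coe).extend_eq
    (Space.continuous_inner S) (x, y)

theorem continuous_innerC :
    Continuous fun p : Completion S.Space × Completion S.Space => S.innerC p.1 p.2 := by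
  let φ : S.Space →+ S.Space →+ A :=
    { toFun := fun x => ((Space.form S).innerₛₗ x).toAddMonoidHom
      map_zero' := by ext x; exact (Space.form S).inner_zero_left _
      map_add' := fun x y => by ext z; exact (Space.form S).inner_add_left _ _ _ }
  have h : Continuous fun p : S.Space × S.Space => φ p.1 p.2 := Space.continuous_inner S
  exact (Completion.isDenseInducing_toCompl S.Space).extend_Z_bilin
    (Completion.isDenseInducing_toCompl S.Space) h

theorem continuous_innerC' {α : Type*} [TopologicalSpace α] {f g : α → Completion S.Space}
    (hf : Continuous f) (hg : Continuous g) : Continuous fun t => S.innerC (f t) (g t) :=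
  S.continuous_innerC.comp (hf.prodMk hg)

/-- The Hilbert `A`-module obtained from a pre-inner product by dividing out the vectors of length
zero and completing (`Completion` is the Hausdorff completion). -/
noncomputable def completion : HilbertModule A where
  carrier := Completion S.Space
  form :=
    { inner := S.innerC
      inner_add_right := fun x y z => by
        induction x, y, z using Completion.induction_on₃ with
        | hp =>
          exact isClosed_eq
            (S.continuous_innerC' (by fun_prop) (by fun_prop))
            ((S.continuous_innerC' (by fun_prop) (by fun_prop)).add
              (S.continuous_innerC' (by fun_prop) (by fun_prop)))
        | ih x y z =>
          rw [← Completion.coe_add, innerC_coe, innerC_coe, innerC_coe,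
            (Space.form S).inner_add_right]
      inner_op_smul_right := fun x y a => by
        induction x, y using Completion.induction_on₂ with
        | hp =>
          exact isClosed_eq
            (S.continuous_innerC' continuous_fst
              ((continuous_const_smul (op a)).comp continuous_snd))
            ((S.continuous_innerC' continuous_fst continuous_snd).mul continuous_const)
        | ih x y =>
          rw [← Completion.coe_smul, innerC_coe, innerC_coe, (Space.form S).inner_op_smul_right]
      star_inner := fun x y => by
        induction x, y using Completion.induction_on₂ with
        | hp =>
          exact isClosed_eq
            (S.continuous_innerC' continuous_fst continuous_snd).star
            (S.continuous_innerC' continuous_snd continuous_fst)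
        | ih x y => rw [innerC_coe, innerC_coe, (Space.form S).star_inner]
      inner_self_nonneg := fun x => by
        induction x using Completion.induction_on with
        | hp =>
          exact CStarAlgebra.isClosed_nonneg.preimage
            (S.continuous_innerC' continuous_id continuous_id)
        | ih x => rw [innerC_coe]; exact (Space.form S).inner_self_nonneg x }
  norm_sq := fun x => by
    induction x using Completion.induction_on with
    | hp =>
      exact isClosed_eq (by fun_prop) (S.continuous_innerC' continuous_id continuous_id).norm
    | ih x =>
      change _ = ‖S.innerC (x : Completion S.Space) (x : Completion S.Space)‖
      rw [innerC_coe, Completion.norm_coe, Space.norm_sq]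

/-- The class in the completion of a vector. -/
noncomputable def toCompletion : E →ₗ[Aᵐᵒᵖ] S.completion where
  toFun x := ((show S.Space from x : S.Space) : Completion S.Space)
  map_add' x y := Completion.coe_add (α := S.Space) x y
  map_smul' a x := Completion.coe_smul (X := S.Space) a x

theorem inner_toCompletion (x y : E) :
    ⟪S.toCompletion x, S.toCompletion y⟫ = S.inner x y := S.innerC_coe x y

theorem denseRange_toCompletion : DenseRange S.toCompletion :=
  Completion.denseRange_coe (α := S.Space)

theorem completion_induction {p : S.completion → Prop} (x : S.completion)
    (hp : IsClosed {x | p x}) (ih : ∀ e, p (S.toCompletion e)) : p x :=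
  S.denseRange_toCompletion.induction_on x hp ih

theorem completion_induction₂ {p : S.completion → S.completion → Prop} (x y : S.completion)
    (hp : IsClosed {x : S.completion × S.completion | p x.1 x.2})
    (ih : ∀ e f, p (S.toCompletion e) (S.toCompletion f)) : p x y :=
  S.denseRange_toCompletion.induction_on₂ hp ih x y

variable {S}

theorem norm_map_eq {Z : HilbertModule A} {f : E →ₗ[Aᵐᵒᵖ] Z}
    (hf : ∀ x y, ⟪f x, f y⟫ = S.inner x y) (x : E) : ‖f x‖ = ‖(show S.Space from x)‖ := by
  refine (sq_eq_sq₀ (norm_nonneg _) (norm_nonneg _)).1 ?_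
  rw [Z.norm_sq, Space.norm_sq]
  exact congrArg norm (hf x x)

/-- The continuous extension to the completion of a map that preserves the pre-inner product. -/
noncomputable def extendFun {Z : HilbertModule A} (f : E →ₗ[Aᵐᵒᵖ] Z) : S.completion → Z :=
  Completion.extension (fun x : S.Space => f x)

theorem continuous_extendFun {Z : HilbertModule A} (f : E →ₗ[Aᵐᵒᵖ] Z) :
    Continuous (extendFun (S := S) f) := Completion.continuous_extension

theorem extendFun_toCompletion {Z : HilbertModule A} (f : E →ₗ[Aᵐᵒᵖ] Z)
    (hf : ∀ x y, ⟪f x, f y⟫ = S.inner x y) (x : E) :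
    extendFun f (S.toCompletion x) = f x := by
  let f' : S.Space →+ Z := AddMonoidHom.mk' (fun x : S.Space => f x) (fun x y => f.map_add x y)
  have hu : UniformContinuous f' :=
    (AddMonoidHomClass.isometry_of_norm (E := S.Space) f'
      (fun x => norm_map_eq hf x)).uniformContinuous
  exact Completion.extension_coe hu x

/-- An `A`-linear map into a Hilbert module that preserves the pre-inner product extends to an
inner-product preserving map on the completion. -/
noncomputable def extend {Z : HilbertModule A} (f : E →ₗ[Aᵐᵒᵖ] Z)
    (hf : ∀ x y, ⟪f x, f y⟫ = S.inner x y) : InnerMap S.completion Z where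
  toFun := extendFun f
  map_add' x y := by
    have hc := continuous_extendFun (S := S) f
    refine S.completion_induction₂ (p := fun x y => extendFun f (x + y) =
      extendFun f x + extendFun f y) x y (isClosed_eq (hc.comp continuous_add)
      ((hc.comp continuous_fst).add (hc.comp continuous_snd))) fun e e' => ?_
    rw [← map_add, extendFun_toCompletion f hf, extendFun_toCompletion f hf,
      extendFun_toCompletion f hf, map_add]
  map_smul' a x := by
    have hc := continuous_extendFun (S := S) f
    refine S.completion_induction (p := fun x => extendFun f (a • x) = a • extendFun f x) x
      (isClosed_eq (hc.comp (continuous_const_smul a))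
      (hc.const_smul a)) fun e => ?_
    rw [← map_smul, extendFun_toCompletion f hf, extendFun_toCompletion f hf, map_smul]
  inner_map x y := by
    have hc := continuous_extendFun (S := S) f
    refine S.completion_induction₂
      (p := fun x y => ⟪extendFun f x, extendFun f y⟫ = ⟪x, y⟫) x y (isClosed_eq
      ((HilbertModule.continuous_inner Z).comp
        ((hc.comp continuous_fst).prodMk (hc.comp continuous_snd)))
      (HilbertModule.continuous_inner _)) fun e e' => ?_
    rw [extendFun_toCompletion f hf, extendFun_toCompletion f hf, hf, inner_toCompletion]

theorem extend_toCompletion {Z : HilbertModule A} (f : E →ₗ[Aᵐᵒᵖ] Z)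
    (hf : ∀ x y, ⟪f x, f y⟫ = S.inner x y) (x : E) :
    extend f hf (S.toCompletion x) = f x := extendFun_toCompletion f hf x

end PreInner

/-! ### Positivity of Gram matrices -/

/-- The algebraic part of the proof that a positive operator is of the form `b⋆ b`. -/
theorem exists_gram_aux {B : Type u} [CStarAlgebra B] (t : B) (ht : IsSelfAdjoint t) :
    ∃ c s : B, star s * t * s = -(star (c * s) * (c * s)) ∧
      (c * s = 0 → ∃ b : B, t = star b * b) := by
  let _ : PartialOrder B := CStarAlgebra.spectralOrder _
  have _ : StarOrderedRing B := CStarAlgebra.spectralOrderedRing _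
  obtain ⟨s, hs⟩ : ∃ s, s = t⁻ := ⟨_, rfl⟩
  have hs0 : 0 ≤ s := hs ▸ CFC.negPart_nonneg t
  have hsa : star s = s := (IsSelfAdjoint.of_nonneg hs0).star_eq
  have hts : t⁺ - s = t := hs ▸ CFC.posPart_sub_negPart t ht
  have hps : t⁺ * s = 0 := hs ▸ CFC.posPart_mul_negPart t
  obtain ⟨c, hc⟩ := CStarAlgebra.nonneg_iff_eq_star_mul_self.1 hs0
  refine ⟨c, s, ?_, fun h => ?_⟩
  · have h1 : t * s = -(s * s) := by
      conv_lhs => rw [← hts]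
      rw [sub_mul, hps, zero_sub]
    have h2 : star c * (c * s) = s * s := by rw [← mul_assoc, ← hc]
    rw [mul_assoc, h1, star_mul, hsa, mul_assoc, h2, mul_neg]
  · have h8 : s = 0 := by
      have h9 : star s * s = 0 := by
        rw [hsa]
        nth_rewrite 1 [hc]
        rw [mul_assoc, h, mul_zero]
      exact CStarRing.star_mul_self_eq_zero_iff _ |>.1 h9
    have h10 : 0 ≤ t := by
      rw [← hts, h8, sub_zero]
      exact CFC.posPart_nonneg t
    exact CStarAlgebra.nonneg_iff_eq_star_mul_self.1 h10

/-- A matrix over `A` with `∑ vᵢ⋆ gᵢⱼ vⱼ ≥ 0` for all `v` is of the form `b⋆ b`. -/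
theorem exists_gram {n : Type u} [Fintype n] (g : n → n → A)
    (hs : ∀ i j, star (g i j) = g j i)
    (hg : ∀ v : n → A, 0 ≤ ∑ i, ∑ j, star (v i) * g i j * v j) :
    ∃ b : n → n → A, ∀ i j, g i j = ∑ k, star (b k i) * b k j := by
  classical
  let t : CStarMatrix n n A := CStarMatrix.ofMatrix (Matrix.of g)
  have ht : IsSelfAdjoint t := by
    ext i j
    exact hs j i
  obtain ⟨c, s, h1, hb⟩ := exists_gram_aux t ht
  have h2 : ∀ k, (star (c * s) * (c * s)) k k ≤ 0 := by
    intro k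
    have h := hg (fun i => s i k)
    have h3 : (star s * t * s) k k = ∑ i, ∑ j, star (s i k) * g i j * s j k := by
      simp only [CStarMatrix.mul_apply, CStarMatrix.star_apply, Finset.sum_mul]
      rw [Finset.sum_comm]
      rfl
    rw [← h3, h1, CStarMatrix.neg_apply] at h
    exact neg_nonneg.1 h
  have h4 : c * s = 0 := by
    ext i k
    have h5 : ∑ l, star ((c * s) l k) * (c * s) l k ≤ 0 := by
      have := h2 k
      rwa [CStarMatrix.mul_apply] at this
    have h6 : star ((c * s) i k) * (c * s) i k ≤ 0 :=
      (Finset.single_le_sum (f := fun l => star ((c * s) l k) * (c * s) l k)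
        (fun l _ => star_mul_self_nonneg _) (Finset.mem_univ i)).trans h5
    have h7 := le_antisymm h6 (star_mul_self_nonneg _)
    exact CStarRing.star_mul_self_eq_zero_iff _ |>.1 h7
  obtain ⟨b, hb⟩ := hb h4
  refine ⟨fun i j => b i j, fun i j => ?_⟩
  have : t i j = (star b * b) i j := by rw [← hb]
  rw [CStarMatrix.mul_apply] at this
  exact this

/-! ### Correspondences and internal tensor products -/

variable (A) in
/-- The `C⋆`-algebra `A` as a Hilbert module `A_A` over itself, with `⟨a, b⟩ = a⋆ b`. -/
noncomputable def HilbertModule.self : HilbertModule A where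
  carrier := A
  form :=
    { inner := fun a b => star a * b
      inner_add_right := fun a b c => mul_add _ _ _
      inner_op_smul_right := fun a b c => (mul_assoc _ _ _).symm
      star_inner := fun a b => by rw [star_mul, star_star]
      inner_self_nonneg := fun a => star_mul_self_nonneg a }
  norm_sq := fun a => by rw [CStarRing.norm_star_mul_self, sq]

variable (A) in
/-- A correspondence over `A`: a right Hilbert `A`-module with a left action of `A` by adjointable
operators, `a ↦ left a` being a `⋆`-homomorphism, so that the adjoint of `left a` is
`left (star a)`. (Linearity over the right action and boundedness of each `left a` are automatic.)
It is not assumed that `left 1` is the identity. -/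
structure Correspondence extends HilbertModule A where
  left : A →ₙₐ[ℂ] Module.End ℂ carrier
  inner_left : ∀ a x y, form.inner (left a x) y = form.inner x (left (star a) y)

instance : CoeSort (Correspondence A) (Type u) := ⟨fun M => M.carrier⟩

theorem Correspondence.left_op_smul (M : Correspondence A) (a : A) (b : Aᵐᵒᵖ) (x : M) :
    M.left a (b • x) = b • M.left a x := by
  have h : ∀ y : M, M.form.inner y (M.left a (b • x) - b • M.left a x) = 0 := fun y => by
    rw [M.form.inner_sub_right, ← op_unop b, M.form.inner_op_smul_right, ← star_star a,
      ← M.inner_left, ← M.inner_left, M.form.inner_op_smul_right, sub_self]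
  have h2 := M.norm_sq (M.left a (b • x) - b • M.left a x)
  rw [h, norm_zero, sq_eq_zero_iff, norm_eq_zero, sub_eq_zero] at h2
  exact h2

/-- The correspondence is essential: `1 · x = x`. -/
def Correspondence.IsEssential (M : Correspondence A) : Prop := ∀ x : M, M.left 1 x = x

/-- The algebraic tensor product `X ⊙ M` over `ℂ`, with `A` acting on the right of `M`. -/
def AlgTensor (X : HilbertModule A) (M : Correspondence A) : Type u := X ⊗[ℂ] M

namespace AlgTensor

variable (X : HilbertModule A) (M : Correspondence A)

noncomputable instance : AddCommGroup (AlgTensor X M) := inferInstanceAs (AddCommGroup (X ⊗[ℂ] M))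
noncomputable instance : Module ℂ (AlgTensor X M) := inferInstanceAs (Module ℂ (X ⊗[ℂ] M))

/-- The right action of `A` on `X ⊙ M`, as a ring homomorphism into the endomorphisms. -/
noncomputable def rightAction : Aᵐᵒᵖ →+* Module.End ℂ (AlgTensor X M) where
  toFun a := LinearMap.lTensor X (Module.toModuleEnd ℂ M a)
  map_one' := by rw [map_one]; exact LinearMap.lTensor_id _ _
  map_mul' a b := by rw [map_mul]; exact LinearMap.lTensor_mul _ _ _
  map_zero' := by rw [map_zero]; exact LinearMap.lTensor_zero _
  map_add' a b := by rw [map_add]; exact LinearMap.lTensor_add _ _ _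

noncomputable instance : Module Aᵐᵒᵖ (AlgTensor X M) := Module.compHom _ (rightAction X M)

instance : IsScalarTower ℂ Aᵐᵒᵖ (AlgTensor X M) where
  smul_assoc c a z := by
    change LinearMap.lTensor X (Module.toModuleEnd ℂ M (c • a)) z
      = c • LinearMap.lTensor X (Module.toModuleEnd ℂ M a) z
    have h : Module.toModuleEnd ℂ (S := Aᵐᵒᵖ) M (c • a) = c • Module.toModuleEnd ℂ M a := by
      ext n
      exact smul_assoc c a n
    rw [h, LinearMap.lTensor_smul]
    rfl

variable {X M}

/-- The elementary tensor `x ⊗ n` in `X ⊙ M`. -/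
def tmul (x : X) (n : M) : AlgTensor X M := x ⊗ₜ[ℂ] n

theorem op_smul_tmul (a : Aᵐᵒᵖ) (x : X) (n : M) : a • tmul x n = tmul x (a • n) := rfl

@[elab_as_elim]
theorem induction_on {p : AlgTensor X M → Prop} (z : AlgTensor X M) (zero : p 0)
    (tmul : ∀ x n, p (tmul x n)) (add : ∀ z w, p z → p w → p (z + w)) : p z :=
  TensorProduct.induction_on (motive := p) z zero tmul add

/-- For fixed `x, n`, the map `y ⊗ p ↦ ⟨n, ⟨x, y⟩ · p⟩`. -/
noncomputable def innerAux (x : X) (n : M) : AlgTensor X M →ₗ[ℂ] A :=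
  TensorProduct.lift (LinearMap.mk₂ ℂ (fun y p => M.form.inner n (M.left (X.form.inner x y) p))
    (fun y y' p => by
      rw [X.form.inner_add_right, map_add, LinearMap.add_apply, M.form.inner_add_right])
    (fun c y p => by
      rw [X.form.inner_smul_right, map_smul, LinearMap.smul_apply, M.form.inner_smul_right])
    (fun y p p' => by rw [map_add, M.form.inner_add_right])
    (fun c y p => by rw [map_smul, M.form.inner_smul_right]))

theorem innerAux_tmul (x y : X) (n p : M) :
    innerAux x n (tmul y p) = M.form.inner n (M.left (X.form.inner x y) p) := rfl

theorem hom_ext {f g : AlgTensor X M →ₗ[ℂ] A} (h : ∀ x n, f (tmul x n) = g (tmul x n)) : f = g :=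
  TensorProduct.ext' h

variable (X M) in
/-- The pre-inner product as a sesquilinear map. -/
noncomputable def innerLin : AlgTensor X M →ₗ⋆[ℂ] AlgTensor X M →ₗ[ℂ] A :=
  TensorProduct.lift (LinearMap.mk₂'ₛₗ (starRingEnd ℂ) (starRingEnd ℂ) innerAux
    (fun x x' n => hom_ext fun y p => by
      rw [LinearMap.add_apply, innerAux_tmul, innerAux_tmul, innerAux_tmul,
        X.form.inner_add_left, map_add, LinearMap.add_apply, M.form.inner_add_right])
    (fun c x n => hom_ext fun y p => by
      rw [LinearMap.smul_apply, innerAux_tmul, innerAux_tmul, X.form.inner_smul_left, map_smul,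
        LinearMap.smul_apply, M.form.inner_smul_right]; rfl)
    (fun x n n' => hom_ext fun y p => by
      rw [LinearMap.add_apply, innerAux_tmul, innerAux_tmul, innerAux_tmul,
        M.form.inner_add_left])
    (fun c x n => hom_ext fun y p => by
      rw [LinearMap.smul_apply, innerAux_tmul, innerAux_tmul, M.form.inner_smul_left]; rfl))

theorem innerLin_tmul (x y : X) (n p : M) :
    innerLin X M (tmul x n) (tmul y p) = M.form.inner n (M.left (X.form.inner x y) p) := rfl

theorem innerLin_star (z w : AlgTensor X M) : star (innerLin X M z w) = innerLin X M w z := by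
  induction z using induction_on with
  | zero => rw [map_zero, map_zero, LinearMap.zero_apply, star_zero]
  | add z z' h h' => rw [map_add, map_add, LinearMap.add_apply, star_add, h, h']
  | tmul x n =>
    induction w using induction_on with
    | zero => rw [map_zero, map_zero, LinearMap.zero_apply, star_zero]
    | add w w' h h' => rw [map_add, map_add, LinearMap.add_apply, star_add, h, h']
    | tmul y p =>
      rw [innerLin_tmul, innerLin_tmul, M.form.star_inner, M.inner_left, X.form.star_inner]

theorem innerLin_op_smul (z w : AlgTensor X M) (a : A) :
    innerLin X M z (op a • w) = innerLin X M z w * a := by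
  induction w using induction_on with
  | zero => rw [smul_zero, map_zero, zero_mul]
  | add w w' h h' => rw [smul_add, map_add, map_add, add_mul, h, h']
  | tmul y p =>
    induction z using induction_on with
    | zero => rw [map_zero, LinearMap.zero_apply, LinearMap.zero_apply, zero_mul]
    | add z z' h h' => rw [map_add, LinearMap.add_apply, LinearMap.add_apply, add_mul, h, h']
    | tmul x n =>
      rw [op_smul_tmul, innerLin_tmul, innerLin_tmul, M.left_op_smul, M.form.inner_op_smul_right]

theorem exists_sum_tmul (z : AlgTensor X M) :
    ∃ (s : Finset (X × M)), z = ∑ i ∈ s, tmul i.1 i.2 :=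
  TensorProduct.exists_finset z

theorem innerLin_self_nonneg (z : AlgTensor X M) : 0 ≤ innerLin X M z z := by
  obtain ⟨s, rfl⟩ := exists_sum_tmul z
  obtain ⟨b, hb⟩ := exists_gram (n := s) (fun i j => X.form.inner i.1.1 j.1.1)
    (fun i j => X.form.star_inner _ _) (fun v => by
      have h := X.form.inner_self_nonneg (∑ i : s, op (v i) • i.1.1)
      have h2 : X.form.inner (∑ i : s, op (v i) • i.1.1) (∑ i : s, op (v i) • i.1.1)
          = ∑ i : s, ∑ j : s, star (v i) * X.form.inner i.1.1 j.1.1 * v j := by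
        rw [← X.form.innerₛₗ_apply, LinearMap.map_sum₂]
        refine Finset.sum_congr rfl fun i _ => ?_
        rw [map_sum]
        refine Finset.sum_congr rfl fun j _ => ?_
        rw [X.form.innerₛₗ_apply, X.form.inner_op_smul_left, X.form.inner_op_smul_right, mul_assoc]
      rwa [h2] at h)
  have key : innerLin X M (∑ i ∈ s, tmul i.1 i.2) (∑ i ∈ s, tmul i.1 i.2)
      = ∑ k : s, M.form.inner (∑ i : s, M.left (b k i) i.1.2) (∑ j : s, M.left (b k j) j.1.2) := by
    rw [← Finset.sum_coe_sort s, LinearMap.map_sum₂]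
    have h1 : ∀ i : s, innerLin X M (tmul i.1.1 i.1.2) (∑ j : s, tmul j.1.1 j.1.2)
        = ∑ j : s, ∑ k : s, M.form.inner (M.left (b k i) i.1.2) (M.left (b k j) j.1.2) := by
      intro i
      rw [map_sum]
      refine Finset.sum_congr rfl fun j _ => ?_
      rw [innerLin_tmul, hb i j, map_sum, LinearMap.sum_apply, ← M.form.innerₛₗ_apply, map_sum]
      refine Finset.sum_congr rfl fun k _ => ?_
      rw [M.form.innerₛₗ_apply, map_mul, M.inner_left]
      rfl
    rw [Finset.sum_congr rfl fun i _ => h1 i]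
    have h2 : ∀ k : s,
        M.form.inner (∑ i : s, M.left (b k i) i.1.2) (∑ j : s, M.left (b k j) j.1.2)
        = ∑ i : s, ∑ j : s, M.form.inner (M.left (b k i) i.1.2) (M.left (b k j) j.1.2) := by
      intro k
      rw [← M.form.innerₛₗ_apply, LinearMap.map_sum₂]
      refine Finset.sum_congr rfl fun i _ => ?_
      rw [map_sum]
      rfl
    rw [Finset.sum_congr rfl fun k _ => h2 k, Finset.sum_comm]
    rw [Finset.sum_comm]
    conv_rhs => rw [Finset.sum_comm]
    exact Finset.sum_congr rfl fun i _ => Finset.sum_comm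
  rw [key]
  exact Finset.sum_nonneg fun k _ => M.form.inner_self_nonneg _

variable (X M) in
/-- The pre-inner product `⟨x ⊗ n, y ⊗ p⟩ = ⟨n, ⟨x, y⟩ · p⟩` on `X ⊙ M`. -/
noncomputable def form : PreInner A (AlgTensor X M) where
  inner z w := innerLin X M z w
  inner_add_right _ _ _ := map_add _ _ _
  inner_op_smul_right z w a := innerLin_op_smul z w a
  star_inner := innerLin_star
  inner_self_nonneg := innerLin_self_nonneg

end AlgTensor

namespace HilbertModule

variable (X Y Z : HilbertModule A) (M : Correspondence A)

/-- The internal tensor product `X ⊗_A M`: the Hausdorff completion of `X ⊙ M` for the inner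
product determined by `⟨x ⊗ n, y ⊗ p⟩ = ⟨n, ⟨x, y⟩ · p⟩`. -/
noncomputable def tensor : HilbertModule A := (AlgTensor.form X M).completion

variable {X Y Z M}

/-- The elementary tensor `x ⊗ n` in `X ⊗_A M`. -/
noncomputable def tmul (x : X) (n : M) : X.tensor M :=
  (AlgTensor.form X M).toCompletion (AlgTensor.tmul x n)

theorem inner_tmul (x y : X) (n p : M) :
    ⟪tmul x n, tmul y p⟫ = M.form.inner n (M.left ⟪x, y⟫ p) :=
  (AlgTensor.form X M).inner_toCompletion _ _

theorem tmul_add (x : X) (n p : M) : tmul x (n + p) = tmul x n + tmul x p := by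
  have h : AlgTensor.tmul x (n + p) = AlgTensor.tmul x n + AlgTensor.tmul x p :=
    TensorProduct.tmul_add x n p
  rw [tmul, h, map_add]
  rfl

theorem tmul_op_smul (x : X) (n : M) (a : Aᵐᵒᵖ) : tmul x (a • n) = a • tmul x n := by
  rw [tmul, ← AlgTensor.op_smul_tmul, map_smul]
  rfl

end HilbertModule

namespace InnerMap

variable {X Y Z : HilbertModule A}

/-- `T ⊙ id` on the algebraic tensor products. -/
noncomputable def algTensorMap (T : InnerMap X Y) (M : Correspondence A) :
    AlgTensor X M →ₗ[Aᵐᵒᵖ] AlgTensor Y M :=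
  let f : AlgTensor X M →ₗ[ℂ] AlgTensor Y M := LinearMap.rTensor M
    { toFun := T, map_add' := map_add T, map_smul' := T.map_smul : X →ₗ[ℂ] Y }
  { toFun := f
    map_add' := f.map_add
    map_smul' := fun a z => by
      rw [RingHom.id_apply]
      induction z using AlgTensor.induction_on with
      | zero => rw [smul_zero, map_zero, smul_zero]
      | add z w h h' => rw [smul_add, map_add, map_add, smul_add, h, h']
      | tmul x n => rfl }

theorem algTensorMap_tmul (T : InnerMap X Y) (M : Correspondence A) (x : X) (n : M) :
    T.algTensorMap M (AlgTensor.tmul x n) = AlgTensor.tmul (T x) n := rfl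

theorem inner_algTensorMap (T : InnerMap X Y) (M : Correspondence A) (z w : AlgTensor X M) :
    (AlgTensor.form Y M).inner (T.algTensorMap M z) (T.algTensorMap M w)
      = (AlgTensor.form X M).inner z w := by
  induction z using AlgTensor.induction_on with
  | zero => rw [map_zero, PreInner.inner_zero_left, PreInner.inner_zero_left]
  | add z z' h h' => rw [map_add, PreInner.inner_add_left, PreInner.inner_add_left, h, h']
  | tmul x n =>
    induction w using AlgTensor.induction_on with
    | zero => rw [map_zero, PreInner.inner_zero_right, PreInner.inner_zero_right]
    | add w w' h h' => rw [map_add, PreInner.inner_add_right, PreInner.inner_add_right, h, h']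
    | tmul y p =>
      change M.form.inner n (M.left ⟪T x, T y⟫ p) = M.form.inner n (M.left ⟪x, y⟫ p)
      rw [T.inner_apply]

/-- `T ⊗ id : X ⊗_A M → Y ⊗_A M`, for an inner-product preserving map `T : X → Y`. -/
noncomputable def tensorId (T : InnerMap X Y) (M : Correspondence A) :
    InnerMap (X.tensor M) (Y.tensor M) :=
  PreInner.extend ((AlgTensor.form Y M).toCompletion ∘ₗ T.algTensorMap M) fun z w =>
    ((AlgTensor.form Y M).inner_toCompletion _ _).trans (T.inner_algTensorMap M z w)

theorem tensorId_tmul (T : InnerMap X Y) (M : Correspondence A) (x : X) (n : M) :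
    T.tensorId M (HilbertModule.tmul x n) = HilbertModule.tmul (T x) n :=
  PreInner.extend_toCompletion _ _ _

end InnerMap

/-! ### Tensor powers -/

namespace HilbertModule

/-- `X ⊗_A M^{⊗k} = X ⊗_A M ⊗_A ⋯ ⊗_A M` with `k` factors `M`. -/
noncomputable def tensorPow (X : HilbertModule A) (M : Correspondence A) : ℕ → HilbertModule A
  | 0 => X
  | k + 1 => (X.tensorPow M k).tensor M

/-- For a submodule `V` of `X`, the copy of `V ⊗_A M` in `X ⊗_A M`: the closed submodule generated
by the elementary tensors `v ⊗ n` with `v ∈ V`. -/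
noncomputable def subTensor {X : HilbertModule A} (V : Submodule Aᵐᵒᵖ X) (M : Correspondence A) :
    Submodule Aᵐᵒᵖ (X.tensor M) :=
  (Submodule.span Aᵐᵒᵖ {z | ∃ v ∈ V, ∃ n : M, z = tmul v n}).topologicalClosure

/-- For a submodule `V` of `X`, the copy of `V ⊗_A M^{⊗k}` in `X ⊗_A M^{⊗k}`. -/
noncomputable def subTensorPow {X : HilbertModule A} (V : Submodule Aᵐᵒᵖ X)
    (M : Correspondence A) : (k : ℕ) → Submodule Aᵐᵒᵖ (X.tensorPow M k)
  | 0 => V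
  | k + 1 => subTensor (subTensorPow V M k) M

end HilbertModule

/-- The powers `D^k : X → X ⊗_A M^{⊗k}` of a dilation `D : X → X ⊗_A M`, given by `D^0 = id` and
`D^{k+1} = (D^k ⊗ id) ∘ D`. Each `D^k` is a bijection, since `D` is. -/
noncomputable def HilbertModuleIso.iterate {X : HilbertModule A} {M : Correspondence A}
    (D : HilbertModuleIso X (X.tensor M)) : (k : ℕ) → InnerMap X (X.tensorPow M k)
  | 0 => InnerMap.id X
  | k + 1 => ((D.iterate k).tensorId M).comp D.toInnerMap

namespace Correspondence

variable (M : Correspondence A)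

/-- The tensor powers `M^{⊗k}`, with `M^{⊗0} = A` and `M^{⊗(k+1)} = M^{⊗k} ⊗_A M`. In particular
`M^{⊗1} = A ⊗_A M`, which for essential `M` is identified with `M` through `a ⊗ n ↦ a · n`. -/
noncomputable def pow (k : ℕ) : HilbertModule A := (HilbertModule.self A).tensorPow M k

/-- The element `1` of `M^{⊗0} = A`. -/
def one : M.pow 0 := (1 : A)

/-- The elementary tensor `n₀ ⊗ ⋯ ⊗ n_{k-1}` in `M^{⊗k}`. -/
noncomputable def tprod : (k : ℕ) → (Fin k → M) → M.pow k
  | 0, _ => one M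
  | k + 1, n => HilbertModule.tmul (tprod k (Fin.init n)) (n (Fin.last k))

/-- A filter in `M`. -/
def IsFilter (m : M) : Prop := ⟪(m : M.toHilbertModule), m⟫ = 1

/-- The map `a ↦ e ⊗ m · a`, for `e` in a Hilbert module with `⟨e, e⟩ = 1` and a filter `m`. -/
noncomputable def filterMap {M : Correspondence A} {m : M} (hM : M.IsEssential)
    (hm : M.IsFilter m) {Y : HilbertModule A} (e : Y) (he : ⟪e, e⟫ = 1) :
    InnerMap (HilbertModule.self A) (Y.tensor M) where
  toFun := fun a : A => HilbertModule.tmul e (op a • m)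
  map_add' := fun (a b : A) => by
    rw [← HilbertModule.tmul_add, ← add_smul, ← op_add]; rfl
  map_smul' := fun b (a : A) => by
    rw [RingHom.id_apply, ← HilbertModule.tmul_op_smul, smul_smul]; rfl
  inner_map := fun (a b : A) => by
    have h2 : M.form.inner m m = 1 := hm
    rw [HilbertModule.inner_tmul, he, hM, M.form.inner_op_smul_right, M.form.inner_op_smul_left,
      h2, mul_one]
    rfl

theorem inner_one : ⟪M.one, M.one⟫ = 1 := by
  change star (1 : A) * 1 = 1
  rw [star_one, one_mul]

/-- The maps `T_k : M^{⊗k} → M^{⊗(k+1)}`, `n ↦ m ⊗ n`: `T_0` is `a ↦ m · a`, regarded as a map into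
`A ⊗_A M ≅ M`, and `T_{k+1} = T_k ⊗ id`. See `shift_tprod` for the formula on elementary tensors. -/
noncomputable def shift {M : Correspondence A} {m : M} (hM : M.IsEssential) (hm : M.IsFilter m) :
    (k : ℕ) → InnerMap (M.pow k) (M.pow (k + 1))
  | 0 => filterMap hM hm M.one M.inner_one
  | k + 1 => (shift hM hm k).tensorId M

theorem shift_tprod {M : Correspondence A} {m : M} (hM : M.IsEssential) (hm : M.IsFilter m)
    (k : ℕ) (n : Fin k → M) :
    shift hM hm k (M.tprod k n) = M.tprod (k + 1) (Fin.cons m n) := by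
  induction k with
  | zero =>
    change HilbertModule.tmul M.one (op (1 : A) • m) = HilbertModule.tmul M.one m
    rw [op_one, one_smul]
  | succ k ih =>
    change ((shift hM hm k).tensorId M) (HilbertModule.tmul (M.tprod k (Fin.init n)) (n (Fin.last k)))
      = HilbertModule.tmul (M.tprod (k + 1) (Fin.init (Fin.cons m n : Fin (k + 2) → M)))
        ((Fin.cons m n : Fin (k + 2) → M) (Fin.last (k + 1)))
    rw [InnerMap.tensorId_tmul, ih, ← Fin.succ_last, Fin.cons_succ]
    congr 2
    ext i
    refine Fin.cases ?_ (fun j => ?_) i <;> rfl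

end Correspondence

/-! ### Direct limits -/

section DirectLimit

variable (X : ℕ → HilbertModule A) (T : (k : ℕ) → InnerMap (X k) (X (k + 1)))

/-- The composition `T_{j-1} ∘ ⋯ ∘ T_i : X_i → X_j`. -/
def transition (i j : ℕ) (h : i ≤ j) : X i →ₗ[Aᵐᵒᵖ] X j :=
  Nat.leRecOn (C := fun j => X i →ₗ[Aᵐᵒᵖ] X j) h (fun {k} f => (T k).toLinearMap ∘ₗ f) LinearMap.id

theorem transition_self (i : ℕ) (x : X i) : transition X T i i le_rfl x = x := by
  rw [transition, Nat.leRecOn_self]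
  rfl

theorem transition_succ (i j : ℕ) (h : i ≤ j) (x : X i) :
    transition X T i (j + 1) (h.trans j.le_succ) x = T j (transition X T i j h x) := by
  rw [transition, Nat.leRecOn_succ h]
  rfl

theorem inner_transition (i j : ℕ) (h : i ≤ j) (x y : X i) :
    ⟪transition X T i j h x, transition X T i j h y⟫ = ⟪x, y⟫ := by
  induction j, h using Nat.le_induction with
  | base => rw [transition_self, transition_self]
  | succ j h ih => rw [transition_succ X T i j h, transition_succ X T i j h, (T j).inner_apply, ih]

instance : DirectedSystem (fun k => X k) (fun i j h => transition X T i j h) where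
  map_self i x := transition_self X T i x
  map_map k j i hij hjk x := by
    induction k, hjk using Nat.le_induction with
    | base => rw [transition_self]
    | succ k h ih => rw [transition_succ X T _ k h, transition_succ X T _ k (hij.trans h), ih]

/-- The algebraic direct limit: the quotient of the disjoint union of the `X_k` identifying
`x ∈ X_k` with `T_k x ∈ X_{k+1}`. -/
def AlgLimit : Type u := DirectLimit (fun k => X k) (fun i j h => transition X T i j h)

namespace AlgLimit

noncomputable instance : AddCommGroup (AlgLimit X T) :=
  inferInstanceAs (AddCommGroup (DirectLimit (fun k => X k) (fun i j h => transition X T i j h)))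

noncomputable instance : Module Aᵐᵒᵖ (AlgLimit X T) :=
  inferInstanceAs (Module Aᵐᵒᵖ (DirectLimit (fun k => X k) (fun i j h => transition X T i j h)))

noncomputable instance : Module ℂ (AlgLimit X T) := Module.compHom _ (algebraMap ℂ Aᵐᵒᵖ)

instance : IsScalarTower ℂ Aᵐᵒᵖ (AlgLimit X T) where
  smul_assoc c a x := by
    change (c • a) • x = algebraMap ℂ Aᵐᵒᵖ c • a • x
    rw [smul_smul, Algebra.smul_def]

/-- The class of `x ∈ X_k` in the algebraic direct limit. -/
noncomputable def of (k : ℕ) : X k →ₗ[Aᵐᵒᵖ] AlgLimit X T :=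
  DirectLimit.Module.of Aᵐᵒᵖ ℕ (fun k => X k) (fun i j h => transition X T i j h) k

/-- The inner product of two classes, computed in any `X_k` in which both are represented. -/
noncomputable def inner (x y : AlgLimit X T) : A :=
  DirectLimit.lift₂ (fun i j h => transition X T i j h) (fun i j h => transition X T i j h)
    (fun k (x y : X k) => ⟪x, y⟫)
    (fun i j h x y => (inner_transition X T i j h x y).symm) x y

theorem inner_of (k : ℕ) (x y : X k) : inner X T (of X T k x) (of X T k y) = ⟪x, y⟫ :=
  DirectLimit.lift₂_def (fun i j h => transition X T i j h) (fun i j h => transition X T i j h)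
    (fun k (x y : X k) => ⟪x, y⟫)
    (fun i j h x y => (inner_transition X T i j h x y).symm) k x y

theorem exists_of (x : AlgLimit X T) : ∃ k x', x = of X T k x' :=
  DirectLimit.exists_eq_mk (fun i j h => transition X T i j h) x

theorem exists_of₂ (x y : AlgLimit X T) : ∃ k x' y', x = of X T k x' ∧ y = of X T k y' :=
  DirectLimit.exists_eq_mk₂ (fun i j h => transition X T i j h) x y

theorem exists_of₃ (x y z : AlgLimit X T) :
    ∃ k x' y' z', x = of X T k x' ∧ y = of X T k y' ∧ z = of X T k z' :=
  DirectLimit.exists_eq_mk₃ (fun i j h => transition X T i j h) x y z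

/-- The inner product on the algebraic direct limit. -/
noncomputable def form : PreInner A (AlgLimit X T) where
  inner := inner X T
  inner_add_right x y z := by
    obtain ⟨k, x, y, z, rfl, rfl, rfl⟩ := exists_of₃ X T x y z
    rw [← map_add, inner_of, inner_of, inner_of]
    exact (X k).form.inner_add_right x y z
  inner_op_smul_right x y a := by
    obtain ⟨k, x, y, rfl, rfl⟩ := exists_of₂ X T x y
    rw [← map_smul, inner_of, inner_of]
    exact (X k).form.inner_op_smul_right x y a
  star_inner x y := by
    obtain ⟨k, x, y, rfl, rfl⟩ := exists_of₂ X T x y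
    rw [inner_of, inner_of]
    exact (X k).form.star_inner x y
  inner_self_nonneg x := by
    obtain ⟨k, x, rfl⟩ := exists_of X T x
    rw [inner_of]
    exact (X k).form.inner_self_nonneg x

end AlgLimit

/-- The direct limit `X_∞ = lim (X_k, T_k)` of Hilbert modules: the completion of the algebraic
direct limit. -/
noncomputable def HilbertModule.limit : HilbertModule A := (AlgLimit.form X T).completion

/-- The canonical maps `ι^k : X_k → X_∞`. -/
noncomputable def HilbertModule.ι (k : ℕ) : InnerMap (X k) (HilbertModule.limit X T) where
  toLinearMap := (AlgLimit.form X T).toCompletion ∘ₗ AlgLimit.of X T k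
  inner_map x y := ((AlgLimit.form X T).inner_toCompletion _ _).trans (AlgLimit.inner_of X T k x y)

theorem HilbertModule.ι_succ (k : ℕ) (x : X k) :
    HilbertModule.ι X T (k + 1) (T k x) = HilbertModule.ι X T k x := by
  have h : AlgLimit.of X T (k + 1) (T k x) = AlgLimit.of X T k x := by
    have h1 := transition_succ X T k k le_rfl x
    rw [transition_self] at h1
    rw [← h1]
    exact DirectLimit.Module.of_f
  exact congrArg (AlgLimit.form X T).toCompletion h

end DirectLimit

namespace Correspondence

variable {M : Correspondence A} {m : M} (hM : M.IsEssential) (hm : M.IsFilter m)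

/-- `M_∞ = lim (M^{⊗k}, T_k)`. -/
noncomputable def limit : HilbertModule A := HilbertModule.limit M.pow (shift hM hm)

/-- The canonical maps `ι^k : M^{⊗k} → M_∞`. -/
noncomputable def ι (k : ℕ) : InnerMap (M.pow k) (limit hM hm) :=
  HilbertModule.ι M.pow (shift hM hm) k

end Correspondence

/-! ### Scaling functions and multi-resolution analyses -/

/-- The submodule `V` is a closed complemented submodule of `W`: every `x ∈ W` is a sum `v + w` with
`v ∈ V` and `w ∈ W` orthogonal to `V`. -/
structure IsComplementedIn {X : HilbertModule A} (V W : Submodule Aᵐᵒᵖ X) : Prop where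
  isClosed : IsClosed (V : Set X)
  le : V ≤ W
  exists_add : ∀ x ∈ W, ∃ v ∈ V, ∃ w ∈ W, (∀ v' ∈ V, ⟪v', w⟫ = 0) ∧ v + w = x

/-- `(X, D, φ)` is a scaling function for `m`: `⟨φ, φ⟩ = 1` and `D φ = φ ⊗ m`. -/
structure IsScalingFunction {M : Correspondence A} (m : M) (X : HilbertModule A)
    (D : HilbertModuleIso X (X.tensor M)) (φ : X) : Prop where
  inner_self : ⟪φ, φ⟫ = 1
  dilation : D φ = HilbertModule.tmul φ m

/-- The submodules `V_k` form a projective multi-resolution analysis of the closed submodule `W` of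
`X`, with respect to the dilation `D : X → X ⊗_A M`, which restricts to an isomorphism of `W` onto
`W ⊗_A M`. -/
structure IsProjectiveMRA {M : Correspondence A} {X : HilbertModule A}
    (D : HilbertModuleIso X (X.tensor M)) (W : Submodule Aᵐᵒᵖ X) (V : ℕ → Submodule Aᵐᵒᵖ X) :
    Prop where
  isClosed : IsClosed (W : Set X)
  map_dilation : W.map D.toInnerMap.toLinearMap = HilbertModule.subTensor W M
  complemented_zero : IsComplementedIn (V 0) W
  eq_comap : ∀ k,
    V k = (HilbertModule.subTensorPow (V 0) M k).comap (D.iterate k).toLinearMap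
  complemented_succ : ∀ k, IsComplementedIn (V k) (V (k + 1))
  le : ∀ k, V k ≤ W
  dense : (W : Set X) ⊆ closure (⋃ k, (V k : Set X))

end

/-!
For a dilation `D : X → X ⊗_A M`, dilating means `V ↦ D⁻¹(V ⊗_A M)` for submodules `V` of `X`, and
`e ↦ D⁻¹ ∘ (e ⊗ id)` for inner-product preserving maps `e` into `X`; taking ranges turns one into
the other. The submodules `V_k` are the iterated dilates of `V_0 = φ · A`, so that (ii) holds by
construction. Orthogonal decompositions survive tensoring with `M` and the isometry `D⁻¹`, hence
dilation preserves complementedness, and everything reduces to two facts about `V_0`. It is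
contained in its dilate, because `φ = D⁻¹(φ ⊗ m)`; and it is complemented in every submodule
containing `φ`, with `x ↦ φ · ⟨φ, x⟩` as the orthogonal projection. Since the `V_k` increase and
dilation commutes with closures of suprema, the closure `W` of their union is its own dilate, which
also turns complementedness of `V_0` in `W` into complementedness of every `V_k` in `W`.

The isomorphism `R` exists because dropping the first module of a direct system does not change its
limit and `- ⊗_A M` commutes with direct limits. The iterated dilates of `a ↦ φ · a` are maps
`M^{⊗k} → X` with ranges `V_k`; they are compatible with the maps `T_k`, so they induce `Q`.
-/

section

variable {A : Type u} [CStarAlgebra A] [PartialOrder A] [StarOrderedRing A]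

namespace InnerMap

variable {X Y Z : HilbertModule A}

theorem comp_apply (S : InnerMap Y Z) (T : InnerMap X Y) (x : X) : S.comp T x = S (T x) := rfl

theorem norm_apply (T : InnerMap X Y) (x : X) : ‖T x‖ = ‖x‖ := by
  rw [← sq_eq_sq₀ (norm_nonneg _) (norm_nonneg _), Y.norm_sq, X.norm_sq]
  exact congrArg norm (T.inner_apply x x)

theorem isometry (T : InnerMap X Y) : Isometry T :=
  AddMonoidHomClass.isometry_of_norm T T.norm_apply

theorem continuous (T : InnerMap X Y) : Continuous T := T.isometry.continuous

theorem injective (T : InnerMap X Y) : Function.Injective T := T.isometry.injective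

/-- The range of an inner-product preserving map, as a submodule. -/
abbrev range (T : InnerMap X Y) : Submodule Aᵐᵒᵖ Y := LinearMap.range T.toLinearMap

theorem range_comp (S : InnerMap Y Z) (T : InnerMap X Y) :
    (S.comp T).range = T.range.map S.toLinearMap :=
  LinearMap.range_comp _ _

theorem map_topologicalClosure (T : InnerMap X Y) (V : Submodule Aᵐᵒᵖ X) :
    V.topologicalClosure.map T.toLinearMap = (V.map T.toLinearMap).topologicalClosure :=
  SetLike.coe_injective (T.isometry.isClosedEmbedding.closure_image_eq V).symm

theorem isClosed_map (T : InnerMap X Y) {V : Submodule Aᵐᵒᵖ X} (hV : IsClosed (V : Set X)) :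
    IsClosed (V.map T.toLinearMap : Set Y) :=
  T.isometry.isClosedEmbedding.isClosedMap _ hV

theorem isClosed_range (T : InnerMap X Y) : IsClosed (T.range : Set Y) :=
  T.isometry.isClosedEmbedding.isClosed_range

end InnerMap

namespace HilbertModuleIso

variable {X Y Z : HilbertModule A}

/-- A surjective inner-product preserving map, as an isomorphism. -/
noncomputable def ofSurjective (T : InnerMap X Y) (h : Function.Surjective T) :
    HilbertModuleIso X Y where
  toLinearEquiv := LinearEquiv.ofBijective T.toLinearMap ⟨T.injective, h⟩
  inner_map := T.inner_map

/-- The inverse isomorphism. -/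
def symm (U : HilbertModuleIso X Y) : HilbertModuleIso Y X where
  toLinearEquiv := U.toLinearEquiv.symm
  inner_map x y := by
    rw [← U.inner_map]
    exact congrArg₂ HilbertModule.inner (U.toLinearEquiv.apply_symm_apply x)
      (U.toLinearEquiv.apply_symm_apply y)

/-- Composition of isomorphisms, the first one being applied first. -/
def trans (U : HilbertModuleIso X Y) (V : HilbertModuleIso Y Z) : HilbertModuleIso X Z where
  toLinearEquiv := U.toLinearEquiv.trans V.toLinearEquiv
  inner_map x y := (V.inner_map _ _).trans (U.inner_map x y)

theorem symm_comp_eq (U : HilbertModuleIso X Y) {S : InnerMap Z Y} {T : InnerMap Z X} :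
    U.symm.toInnerMap.comp S = T ↔ S = U.toInnerMap.comp T := by
  simp only [DFunLike.ext_iff]
  exact forall_congr' fun _ => U.toLinearEquiv.symm_apply_eq

end HilbertModuleIso

/-! ### Orthogonality -/

namespace HilbertModule

variable {X : HilbertModule A}

theorem inner_add_right (x y z : X) : ⟪x, y + z⟫ = ⟪x, y⟫ + ⟪x, z⟫ := X.form.inner_add_right x y z

theorem inner_sub_right (x y z : X) : ⟪x, y - z⟫ = ⟪x, y⟫ - ⟪x, z⟫ := X.form.inner_sub_right x y z

theorem inner_zero_right (x : X) : ⟪x, 0⟫ = 0 := X.form.inner_zero_right x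

theorem inner_op_smul_right (x y : X) (a : A) : ⟪x, op a • y⟫ = ⟪x, y⟫ * a :=
  X.form.inner_op_smul_right x y a

theorem inner_op_smul_left (x y : X) (a : A) : ⟪op a • x, y⟫ = star a * ⟪x, y⟫ :=
  X.form.inner_op_smul_left x y a

theorem inner_eq_zero_symm {x y : X} : ⟪x, y⟫ = 0 ↔ ⟪y, x⟫ = 0 := by
  rw [← star_eq_zero, show star ⟪x, y⟫ = ⟪y, x⟫ from X.form.star_inner x y]

theorem norm_le_norm_add_of_inner_eq_zero {x y : X} (h : ⟪x, y⟫ = 0) : ‖x‖ ≤ ‖x + y‖ := by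
  have inner_self_add : X.form.inner (x + y) (x + y) = X.form.inner x x + X.form.inner y y := by
    have hxy : X.form.inner x y = 0 := h
    have hyx : X.form.inner y x = 0 := inner_eq_zero_symm.1 h
    rw [X.form.inner_add_left, X.form.inner_add_right, X.form.inner_add_right, hxy, hyx, add_zero,
      zero_add]
  refine le_of_sq_le_sq ?_ (norm_nonneg _)
  rw [X.norm_sq, X.norm_sq, inner_self_add]
  exact CStarAlgebra.norm_le_norm_of_nonneg_of_le (X.form.inner_self_nonneg x)
    (le_add_of_nonneg_right (X.form.inner_self_nonneg y))

/-- The submodule of all vectors orthogonal to `V`. Since a closed submodule of a Hilbert module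
need not be complemented, `V ⊔ orthogonal V` can be a proper submodule. -/
def orthogonal (V : Submodule Aᵐᵒᵖ X) : Submodule Aᵐᵒᵖ X where
  carrier := {w | ∀ v ∈ V, ⟪v, w⟫ = 0}
  add_mem' hx hy v hv := by rw [inner_add_right, hx v hv, hy v hv, add_zero]
  zero_mem' v _ := inner_zero_right v
  smul_mem' a x hx v hv := by rw [← op_unop a, inner_op_smul_right, hx v hv, zero_mul]

theorem isClosed_orthogonal (V : Submodule Aᵐᵒᵖ X) : IsClosed (orthogonal V : Set X) := by
  have h : (orthogonal V : Set X) = ⋂ v ∈ V, {w | ⟪v, w⟫ = 0} := by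
    ext w
    simp only [Set.mem_iInter, Set.mem_ofPred_eq]
    rfl
  rw [h]
  exact isClosed_biInter fun v _ => isClosed_eq
    (X.continuous_inner.comp (continuous_const.prodMk continuous_id)) continuous_const

theorem le_orthogonal_comm {V W : Submodule Aᵐᵒᵖ X} : V ≤ orthogonal W ↔ W ≤ orthogonal V :=
  ⟨fun h _ hw _ hv => inner_eq_zero_symm.1 (h hv _ hw),
    fun h _ hv _ hw => inner_eq_zero_symm.1 (h hw _ hv)⟩

theorem map_orthogonal_le {Y : HilbertModule A} (T : InnerMap X Y) (V : Submodule Aᵐᵒᵖ X) :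
    (orthogonal V).map T.toLinearMap ≤ orthogonal (V.map T.toLinearMap) := by
  rintro _ ⟨w, hw, rfl⟩ _ ⟨v, hv, rfl⟩
  exact (T.inner_apply v w).trans (hw v hv)

theorem isClosed_sup_of_le_orthogonal {V W : Submodule Aᵐᵒᵖ X} (hV : IsClosed (V : Set X))
    (hW : IsClosed (W : Set X)) (h : W ≤ orthogonal V) :
    IsClosed ((V ⊔ W : Submodule Aᵐᵒᵖ X) : Set X) := by
  have := hV.completeSpace_coe
  have := hW.completeSpace_coe
  let add : V × W →ₗ[Aᵐᵒᵖ] X := V.subtype.coprod W.subtype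
  have antilipschitz_add : AntilipschitzWith 1 add :=
    AddMonoidHomClass.antilipschitz_of_bound add fun ⟨v, w⟩ => by
      have hvw : ⟪(v : X), (w : X)⟫ = 0 := h w.2 v v.2
      rw [NNReal.coe_one, one_mul]
      refine max_le (norm_le_norm_add_of_inner_eq_zero hvw) ?_
      exact (norm_le_norm_add_of_inner_eq_zero (inner_eq_zero_symm.1 hvw)).trans_eq
        (congrArg norm (add_comm _ _))
  have uniformContinuous_add : UniformContinuous add :=
    (uniformContinuous_subtype_val.comp uniformContinuous_fst).add
      (uniformContinuous_subtype_val.comp uniformContinuous_snd)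
  have range_add : LinearMap.range add = V ⊔ W := by
    rw [LinearMap.range_coprod, V.range_subtype, W.range_subtype]
  rw [← range_add]
  exact antilipschitz_add.isClosed_range uniformContinuous_add

end HilbertModule

namespace IsComplementedIn

open HilbertModule

variable {X Y : HilbertModule A} {U V W : Submodule Aᵐᵒᵖ X}

theorem of_sup_eq (hV : IsClosed (V : Set X)) (hU : U ≤ orthogonal V) (h : V ⊔ U = W) :
    IsComplementedIn V W where
  isClosed := hV
  le := h ▸ le_sup_left
  exists_add x hx := by
    obtain ⟨v, hv, w, hw, hvw⟩ := Submodule.mem_sup.1 (h ▸ hx)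
    exact ⟨v, hv, w, h ▸ Submodule.mem_sup_right hw, hU hw, hvw⟩

theorem sup_inf_orthogonal (h : IsComplementedIn V W) : V ⊔ W ⊓ orthogonal V = W := by
  refine le_antisymm (sup_le h.le inf_le_left) fun x hx => ?_
  obtain ⟨v, hv, w, hw, hvw, rfl⟩ := h.exists_add x hx
  exact Submodule.add_mem_sup hv ⟨hw, hvw⟩

theorem mono_right (h : IsComplementedIn V W) (hVU : V ≤ U) (hUW : U ≤ W) :
    IsComplementedIn V U where
  isClosed := h.isClosed
  le := hVU
  exists_add x hx := by
    obtain ⟨v, hv, w, -, hvw, rfl⟩ := h.exists_add x (hUW hx)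
    exact ⟨v, hv, w, (U.add_mem_iff_right (hVU hv)).1 hx, hvw, rfl⟩

theorem map (h : IsComplementedIn V W) (T : InnerMap X Y) :
    IsComplementedIn (V.map T.toLinearMap) (W.map T.toLinearMap) :=
  of_sup_eq (T.isClosed_map h.isClosed)
    ((Submodule.map_mono inf_le_right).trans (map_orthogonal_le T V))
    (by rw [← Submodule.map_sup, h.sup_inf_orthogonal])

end IsComplementedIn

/-! ### Submodules of tensor products -/

namespace HilbertModule

variable {X Y : HilbertModule A} {M : Correspondence A}

theorem add_tmul (x y : X) (n : M) : tmul (x + y) n = tmul x n + tmul y n := by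
  have h : AlgTensor.tmul (x + y) n = AlgTensor.tmul x n + AlgTensor.tmul y n :=
    TensorProduct.add_tmul x y n
  rw [tmul, h, map_add]
  rfl

theorem zero_tmul (n : M) : tmul (0 : X) n = 0 := by
  simpa only [add_zero, left_eq_add] using add_tmul (0 : X) 0 n

/-- The matrix coefficient `a ↦ ⟨n, a · n⟩`, as a positive linear map. Positive maps between
`C⋆`-algebras are automatically continuous. -/
noncomputable def leftCoeff (n : M) : A →ₚ[ℂ] A :=
  .mk₀ (M.form.innerₛₗ n ∘ₗ LinearMap.applyₗ n ∘ₗ (M.left : A →ₗ[ℂ] Module.End ℂ M)) fun a ha => by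
    obtain ⟨b, rfl⟩ := CStarAlgebra.nonneg_iff_eq_star_mul_self.1 ha
    change 0 ≤ M.form.inner n (M.left (star b * b) n)
    rw [map_mul, Module.End.mul_apply, ← M.inner_left]
    exact M.form.inner_self_nonneg _

theorem continuous_tmul_left (n : M) : Continuous fun x : X => tmul x n := by
  let f : X →+ X.tensor M := AddMonoidHom.mk' (fun x => tmul x n) fun x y => add_tmul x y n
  have norm_f (x : X) : ‖f x‖ = √‖leftCoeff n ⟪x, x⟫‖ := by
    rw [← Real.sqrt_sq (norm_nonneg (f x)), (X.tensor M).norm_sq]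
    exact congrArg (√‖·‖) (inner_tmul x x n n)
  have continuous_norm_f : Continuous fun x => ‖f x‖ := by
    simp only [norm_f]
    exact ((map_continuous (leftCoeff n)).comp
      (X.continuous_inner.comp (continuous_id.prodMk continuous_id))).norm.sqrt
  refine continuous_of_continuousAt_zero f (tendsto_iff_norm_sub_tendsto_zero.2 ?_)
  simpa only [map_zero, sub_zero, norm_zero] using continuous_norm_f.tendsto 0

theorem tmul_mem_subTensor {V : Submodule Aᵐᵒᵖ X} {x : X} (hx : x ∈ V) (n : M) :
    tmul x n ∈ subTensor V M :=
  Submodule.le_topologicalClosure _ (Submodule.subset_span ⟨x, hx, n, rfl⟩)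

theorem isClosed_subTensor (V : Submodule Aᵐᵒᵖ X) : IsClosed (subTensor V M : Set (X.tensor M)) :=
  Submodule.isClosed_topologicalClosure _

theorem subTensor_le {V : Submodule Aᵐᵒᵖ X} {U : Submodule Aᵐᵒᵖ (X.tensor M)}
    (hU : IsClosed (U : Set (X.tensor M))) (h : ∀ x ∈ V, ∀ n : M, tmul x n ∈ U) :
    subTensor V M ≤ U :=
  Submodule.topologicalClosure_minimal _
    (Submodule.span_le.2 (by rintro _ ⟨x, hx, n, rfl⟩; exact h x hx n)) hU

theorem subTensor_mono {V W : Submodule Aᵐᵒᵖ X} (h : V ≤ W) : subTensor V M ≤ subTensor W M :=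
  subTensor_le (isClosed_subTensor W) fun _ hx n => tmul_mem_subTensor (h hx) n

variable (X M) in
theorem subTensor_top : subTensor (⊤ : Submodule Aᵐᵒᵖ X) M = ⊤ := by
  refine eq_top_iff.2 fun z _ => ?_
  refine (AlgTensor.form X M).completion_induction (p := (· ∈ subTensor ⊤ M)) z
    (isClosed_subTensor ⊤) fun e => ?_
  induction e using AlgTensor.induction_on with
  | zero => rw [map_zero]; exact Submodule.zero_mem _
  | tmul x n => exact tmul_mem_subTensor Submodule.mem_top n
  | add z w hz hw => rw [map_add]; exact Submodule.add_mem _ hz hw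

theorem map_tensorId_subTensor (T : InnerMap X Y) (V : Submodule Aᵐᵒᵖ X) :
    (subTensor V M).map (T.tensorId M).toLinearMap = subTensor (V.map T.toLinearMap) M := by
  refine le_antisymm (Submodule.map_le_iff_le_comap.2 ?_)
    (subTensor_le ((T.tensorId M).isClosed_map (isClosed_subTensor V)) ?_)
  · refine subTensor_le ((isClosed_subTensor _).preimage (T.tensorId M).continuous) fun x hx n => ?_
    change T.tensorId M (tmul x n) ∈ subTensor (V.map T.toLinearMap) M
    rw [InnerMap.tensorId_tmul]
    exact tmul_mem_subTensor (Submodule.mem_map_of_mem hx) n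
  · rintro _ ⟨x, hx, rfl⟩ n
    exact ⟨tmul x n, tmul_mem_subTensor hx n, T.tensorId_tmul M x n⟩

theorem subTensor_topologicalClosure (V : Submodule Aᵐᵒᵖ X) :
    subTensor V.topologicalClosure M = subTensor V M := by
  refine le_antisymm (subTensor_le (isClosed_subTensor V) fun x hx n => ?_)
    (subTensor_mono V.le_topologicalClosure)
  exact closure_minimal (t := {x | tmul x n ∈ subTensor V M}) (fun _ hv => tmul_mem_subTensor hv n)
    ((isClosed_subTensor V).preimage (continuous_tmul_left n)) hx

theorem subTensor_iSup {ι : Type*} (V : ι → Submodule Aᵐᵒᵖ X) :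
    subTensor (⨆ i, V i) M = (⨆ i, subTensor (V i) M).topologicalClosure := by
  refine le_antisymm (subTensor_le (Submodule.isClosed_topologicalClosure _) fun x hx n => ?_)
    (Submodule.topologicalClosure_minimal _
      (iSup_le fun i => subTensor_mono (le_iSup V i)) (isClosed_subTensor _))
  refine Submodule.le_topologicalClosure _ ?_
  induction hx using Submodule.iSup_induction' with
  | mem i x hx => exact Submodule.mem_iSup_of_mem i (tmul_mem_subTensor hx n)
  | zero => rw [zero_tmul]; exact Submodule.zero_mem _
  | add x y _ _ hx hy => rw [add_tmul]; exact Submodule.add_mem _ hx hy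

theorem subTensor_orthogonal_le (V : Submodule Aᵐᵒᵖ X) :
    subTensor (orthogonal V) M ≤ orthogonal (subTensor V M) := by
  refine subTensor_le (isClosed_orthogonal _) fun w hw p => ?_
  have h : subTensor V M ≤ orthogonal (Submodule.span Aᵐᵒᵖ {tmul w p}) := by
    refine subTensor_le (isClosed_orthogonal _) fun v hv n u hu => ?_
    obtain ⟨a, rfl⟩ := Submodule.mem_span_singleton.1 hu
    rw [← op_unop a, inner_op_smul_left, inner_tmul, inner_eq_zero_symm.1 (hw v hv), map_zero,
      LinearMap.zero_apply, M.form.inner_zero_right, mul_zero]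
  exact le_orthogonal_comm.1 h (Submodule.mem_span_singleton_self _)

end HilbertModule

namespace IsComplementedIn

open HilbertModule

variable {X : HilbertModule A} {V W : Submodule Aᵐᵒᵖ X}

theorem subTensor (h : IsComplementedIn V W) (M : Correspondence A) :
    IsComplementedIn (subTensor V M) (subTensor W M) := by
  have hU : HilbertModule.subTensor (W ⊓ orthogonal V) M ≤
      orthogonal (HilbertModule.subTensor V M) :=
    (subTensor_mono inf_le_right).trans (subTensor_orthogonal_le V)
  refine of_sup_eq (isClosed_subTensor V) hU (le_antisymm
    (sup_le (subTensor_mono h.le) (subTensor_mono inf_le_left)) (subTensor_le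
      (isClosed_sup_of_le_orthogonal (isClosed_subTensor _) (isClosed_subTensor _) hU)
      fun x hx n => ?_))
  obtain ⟨v, hv, w, hw, rfl⟩ := Submodule.mem_sup.1 (h.sup_inf_orthogonal.ge hx)
  rw [add_tmul]
  exact Submodule.add_mem_sup (tmul_mem_subTensor hv n) (tmul_mem_subTensor hw n)

end IsComplementedIn

namespace InnerMap

open HilbertModule

variable {X Y Z : HilbertModule A} {M : Correspondence A}

theorem tensor_ext {S T : InnerMap (X.tensor M) Z} (h : ∀ x n, S (tmul x n) = T (tmul x n)) :
    S = T := by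
  have eqLocus_eq_top : LinearMap.eqLocus S.toLinearMap T.toLinearMap = ⊤ :=
    top_le_iff.1 (subTensor_top X M ▸
      subTensor_le (isClosed_eq S.continuous T.continuous) fun x _ n => h x n)
  exact DFunLike.ext _ _ fun z => (eqLocus_eq_top ▸ Submodule.mem_top :
    z ∈ LinearMap.eqLocus S.toLinearMap T.toLinearMap)

theorem tensorId_comp (S : InnerMap Y Z) (T : InnerMap X Y) :
    (S.comp T).tensorId M = (S.tensorId M).comp (T.tensorId M) :=
  tensor_ext fun x n => by
    rw [comp_apply, tensorId_tmul, tensorId_tmul, tensorId_tmul, comp_apply]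

theorem range_tensorId (T : InnerMap X Y) : (T.tensorId M).range = subTensor T.range M := by
  rw [range, range, LinearMap.range_eq_map, LinearMap.range_eq_map, ← map_tensorId_subTensor,
    subTensor_top]

end InnerMap

/-! ### Maps out of direct limits -/

section DirectLimit

variable {X : ℕ → HilbertModule A} {T : (k : ℕ) → InnerMap (X k) (X (k + 1))}
  {Z : HilbertModule A}

namespace HilbertModule

theorem ι_comp (k : ℕ) : (ι X T (k + 1)).comp (T k) = ι X T k :=
  DFunLike.ext _ _ (ι_succ X T k)

theorem monotone_range_ι : Monotone fun k => (ι X T k).range :=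
  monotone_nat_of_le_succ fun k => by
    rw [← ι_comp]
    exact LinearMap.range_comp_le_range _ _

theorem eq_top_of_range_ι_le {V : Submodule Aᵐᵒᵖ (limit X T)}
    (hV : IsClosed (V : Set (limit X T))) (h : ∀ k, (ι X T k).range ≤ V) : V = ⊤ := by
  refine eq_top_iff.2 fun z _ => ?_
  refine (AlgLimit.form X T).completion_induction (p := fun z => z ∈ V) z hV fun e => ?_
  obtain ⟨k, x, rfl⟩ := AlgLimit.exists_of X T e
  exact h k ⟨x, rfl⟩

theorem topologicalClosure_iSup_range_ι : (⨆ k, (ι X T k).range).topologicalClosure = ⊤ :=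
  eq_top_of_range_ι_le (Submodule.isClosed_topologicalClosure _) fun k =>
    (le_iSup (fun k => (ι X T k).range) k).trans (Submodule.le_topologicalClosure _)

theorem limit_ext {S S' : InnerMap (limit X T) Z}
    (h : ∀ k, S.comp (ι X T k) = S'.comp (ι X T k)) : S = S' := by
  have eqLocus_eq_top : LinearMap.eqLocus S.toLinearMap S'.toLinearMap = ⊤ := by
    refine eq_top_of_range_ι_le (isClosed_eq S.continuous S'.continuous) fun k => ?_
    rintro _ ⟨x, rfl⟩
    exact DFunLike.congr_fun (h k) x
  exact DFunLike.ext _ _ fun z => (eqLocus_eq_top ▸ Submodule.mem_top :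
    z ∈ LinearMap.eqLocus S.toLinearMap S'.toLinearMap)

section Lift

variable (f : (k : ℕ) → InnerMap (X k) Z) (hf : ∀ k, (f (k + 1)).comp (T k) = f k)

/-- The map on the algebraic direct limit induced by a compatible family of maps `X_k → Z`. -/
noncomputable def algLift : AlgLimit X T →ₗ[Aᵐᵒᵖ] Z :=
  DirectLimit.Module.lift Aᵐᵒᵖ ℕ (fun k => X k) (fun i j h => transition X T i j h)
    (fun k => (f k).toLinearMap) fun i j h x => by
      induction j, h using Nat.le_induction with
      | base => rw [transition_self]
      | succ j h ih =>
        rw [transition_succ X T i j h, ← ih]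
        exact DFunLike.congr_fun (hf j) _

theorem inner_algLift (x y : AlgLimit X T) :
    ⟪algLift f hf x, algLift f hf y⟫ = (AlgLimit.form X T).inner x y := by
  obtain ⟨k, x, y, rfl, rfl⟩ := AlgLimit.exists_of₂ X T x y
  exact ((f k).inner_apply x y).trans (AlgLimit.inner_of X T k x y).symm

/-- The map `X_∞ → Z` induced by a compatible family of inner-product preserving maps
`X_k → Z`. -/
noncomputable def limitLift : InnerMap (limit X T) Z :=
  PreInner.extend (algLift f hf) (inner_algLift f hf)

theorem limitLift_comp_ι (k : ℕ) : (limitLift f hf).comp (ι X T k) = f k :=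
  DFunLike.ext _ _ fun x =>
    PreInner.extend_toCompletion (algLift f hf) (inner_algLift f hf) (AlgLimit.of X T k x)

theorem range_limitLift :
    (limitLift f hf).range = (⨆ k, (f k).range).topologicalClosure := by
  rw [InnerMap.range, LinearMap.range_eq_map, ← topologicalClosure_iSup_range_ι,
    InnerMap.map_topologicalClosure, Submodule.map_iSup]
  simp only [← InnerMap.range_comp, limitLift_comp_ι]

theorem limitLift_surjective (h : (⨆ k, (f k).range).topologicalClosure = ⊤) :
    Function.Surjective (limitLift f hf) :=
  LinearMap.range_eq_top.1 ((range_limitLift f hf).trans h)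

end Lift

variable (X T)

/-- Dropping the first module of a direct system does not change its limit. -/
noncomputable def limitSuccIso :
    HilbertModuleIso (limit (fun k => X (k + 1)) fun k => T (k + 1)) (limit X T) :=
  .ofSurjective (limitLift (fun k => ι X T (k + 1)) fun k => ι_comp (k + 1)) <|
    limitLift_surjective _ _ <| by
      rw [monotone_range_ι.iSup_nat_add 1, topologicalClosure_iSup_range_ι]

theorem limitSuccIso_symm_comp_ι (k : ℕ) :
    (limitSuccIso X T).symm.toInnerMap.comp (ι X T (k + 1)) =
      ι (fun k => X (k + 1)) (fun k => T (k + 1)) k :=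
  (limitSuccIso X T).symm_comp_eq.2
    (limitLift_comp_ι (fun k => ι X T (k + 1)) (fun k => ι_comp (k + 1)) k).symm

/-- Internal tensor products commute with direct limits. -/
noncomputable def limitTensorIso (M : Correspondence A) :
    HilbertModuleIso (limit (fun k => (X k).tensor M) fun k => (T k).tensorId M)
      ((limit X T).tensor M) :=
  .ofSurjective (limitLift (fun k => (ι X T k).tensorId M) fun k => by
      rw [← InnerMap.tensorId_comp, ι_comp]) <|
    limitLift_surjective _ _ <| by
      simp only [InnerMap.range_tensorId]
      rw [← subTensor_iSup, ← subTensor_topologicalClosure, topologicalClosure_iSup_range_ι,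
        subTensor_top]

theorem limitTensorIso_comp_ι (M : Correspondence A) (k : ℕ) :
    (limitTensorIso X T M).toInnerMap.comp
      (ι (fun k => (X k).tensor M) (fun k => (T k).tensorId M) k) = (ι X T k).tensorId M :=
  limitLift_comp_ι _ _ k

end HilbertModule

end DirectLimit

namespace Correspondence

variable {M : Correspondence A} {m : M} (hM : M.IsEssential) (hm : M.IsFilter m)

/-- The isomorphism `M_∞ ≅ M_∞ ⊗_A M` which identifies the copy of `M^{⊗(k+1)}` on the left with
`M^{⊗k} ⊗_A M` on the right. -/
noncomputable def limitDilation : HilbertModuleIso (limit hM hm) ((limit hM hm).tensor M) :=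
  (HilbertModule.limitSuccIso M.pow (shift hM hm)).symm.trans
    (HilbertModule.limitTensorIso M.pow (shift hM hm) M)

theorem limitDilation_comp_ι (k : ℕ) :
    (limitDilation hM hm).toInnerMap.comp (ι hM hm (k + 1)) = (ι hM hm k).tensorId M :=
  (congrArg (HilbertModule.limitTensorIso M.pow (shift hM hm) M).toInnerMap.comp
    (HilbertModule.limitSuccIso_symm_comp_ι M.pow (shift hM hm) k)).trans
      (HilbertModule.limitTensorIso_comp_ι M.pow (shift hM hm) M k)

end Correspondence

/-! ### Dilations of submodules and of maps -/

namespace HilbertModuleIso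

open HilbertModule

variable {X Y : HilbertModule A} {M : Correspondence A} (D : HilbertModuleIso X (X.tensor M))

/-- The dilate `D⁻¹(V ⊗_A M)` of a submodule `V` of `X`. -/
noncomputable def dilate (V : Submodule Aᵐᵒᵖ X) : Submodule Aᵐᵒᵖ X :=
  (subTensor V M).map D.symm.toInnerMap.toLinearMap

theorem dilate_mono : Monotone D.dilate := fun _ _ h => Submodule.map_mono (subTensor_mono h)

theorem map_dilate (V : Submodule Aᵐᵒᵖ X) :
    (D.dilate V).map D.toInnerMap.toLinearMap = subTensor V M := by
  refine (Submodule.map_comp _ _ _).symm.trans ?_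
  exact (congrArg (Submodule.map · _) D.toLinearEquiv.comp_symm).trans (Submodule.map_id _)

theorem dilate_topologicalClosure_iSup {ι : Type*} (V : ι → Submodule Aᵐᵒᵖ X) :
    D.dilate (⨆ i, V i).topologicalClosure = (⨆ i, D.dilate (V i)).topologicalClosure := by
  rw [dilate, subTensor_topologicalClosure, subTensor_iSup, InnerMap.map_topologicalClosure,
    Submodule.map_iSup]
  rfl

theorem map_iterate_dilate_iterate (V : Submodule Aᵐᵒᵖ X) (k : ℕ) :
    (D.dilate^[k] V).map (D.iterate k).toLinearMap = subTensorPow V M k := by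
  induction k with
  | zero => exact Submodule.map_id V
  | succ k ih =>
    rw [Function.iterate_succ_apply']
    exact (Submodule.map_comp _ _ _).trans <| (congrArg (Submodule.map _) (D.map_dilate _)).trans <|
      (map_tensorId_subTensor (D.iterate k) _).trans (congrArg (subTensor · M) ih)

theorem dilate_iterate_eq_comap (V : Submodule Aᵐᵒᵖ X) (k : ℕ) :
    D.dilate^[k] V = (subTensorPow V M k).comap (D.iterate k).toLinearMap := by
  rw [← map_iterate_dilate_iterate, Submodule.comap_map_eq_of_injective (D.iterate k).injective]

theorem isComplementedIn_dilate_iterate {V W : Submodule Aᵐᵒᵖ X} (h : IsComplementedIn V W)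
    (k : ℕ) : IsComplementedIn (D.dilate^[k] V) (D.dilate^[k] W) := by
  induction k with
  | zero => exact h
  | succ k ih =>
    rw [Function.iterate_succ_apply', Function.iterate_succ_apply']
    exact (ih.subTensor M).map D.symm.toInnerMap

theorem isProjectiveMRA_dilate_iterate {V : Submodule Aᵐᵒᵖ X} (hV : V ≤ D.dilate V)
    (h : IsComplementedIn V (⨆ k, D.dilate^[k] V).topologicalClosure) :
    IsProjectiveMRA D (⨆ k, D.dilate^[k] V).topologicalClosure fun k => D.dilate^[k] V := by
  set W := (⨆ k, D.dilate^[k] V).topologicalClosure with W_def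
  have monotone_dilate : Monotone fun k => D.dilate^[k] V :=
    D.dilate_mono.monotone_iterate_of_le_map hV
  have dilate_W : D.dilate W = W := by
    rw [W_def, dilate_topologicalClosure_iSup]
    simp only [← Function.iterate_succ_apply']
    rw [monotone_dilate.iSup_nat_add 1]
  have le_W (k : ℕ) : D.dilate^[k] V ≤ W :=
    (le_iSup (fun k => D.dilate^[k] V) k).trans (Submodule.le_topologicalClosure _)
  have complemented (k : ℕ) : IsComplementedIn (D.dilate^[k] V) W := by
    have := D.isComplementedIn_dilate_iterate h k
    rwa [Function.iterate_fixed dilate_W] at this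
  exact
    { isClosed := Submodule.isClosed_topologicalClosure _
      map_dilation := by rw [← map_dilate, dilate_W]
      complemented_zero := h
      eq_comap := D.dilate_iterate_eq_comap V
      complemented_succ k := (complemented k).mono_right (monotone_dilate k.le_succ) (le_W (k + 1))
      le := le_W
      dense := by
        rw [W_def, Submodule.topologicalClosure_coe,
          Submodule.coe_iSup_of_directed _ monotone_dilate.directed_le] }

/-- The maps `(D^k)⁻¹ ∘ (e ⊗ id) : Y ⊗_A M^{⊗k} → X` obtained from `e : Y → X`. They are defined
through the recursion `e_{k+1} = D⁻¹ ∘ (e_k ⊗ id)`, so that the inverse of `D^k` is not needed. -/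
noncomputable def dilateMap (e : InnerMap Y X) : (k : ℕ) → InnerMap (Y.tensorPow M k) X
  | 0 => e
  | k + 1 => D.symm.toInnerMap.comp ((dilateMap e k).tensorId M)

theorem dilation_comp_dilateMap_succ (e : InnerMap Y X) (k : ℕ) :
    D.toInnerMap.comp (D.dilateMap e (k + 1)) = (D.dilateMap e k).tensorId M :=
  (D.symm_comp_eq.1 rfl).symm

theorem range_dilateMap (e : InnerMap Y X) (k : ℕ) :
    (D.dilateMap e k).range = D.dilate^[k] e.range := by
  induction k with
  | zero => rfl
  | succ k ih =>
    rw [Function.iterate_succ_apply', ← ih, dilate, ← InnerMap.range_tensorId]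
    exact InnerMap.range_comp _ _

theorem dilateMap_succ_comp {e : InnerMap Y X}
    {T : (k : ℕ) → InnerMap (Y.tensorPow M k) (Y.tensorPow M (k + 1))}
    (hT : ∀ k, T (k + 1) = (T k).tensorId M)
    (he : (e.tensorId M).comp (T 0) = D.toInnerMap.comp e) (k : ℕ) :
    (D.dilateMap e (k + 1)).comp (T k) = D.dilateMap e k := by
  induction k with
  | zero => exact D.symm_comp_eq.2 he
  | succ k ih =>
    rw [hT]
    change D.symm.toInnerMap.comp (((D.dilateMap e (k + 1)).tensorId M).comp
      ((T k).tensorId M)) = D.symm.toInnerMap.comp ((D.dilateMap e k).tensorId M)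
    rw [← InnerMap.tensorId_comp, ih]

end HilbertModuleIso

/-! ### The multi-resolution analysis of a scaling function -/

namespace HilbertModule

variable {X : HilbertModule A}

/-- The map `a ↦ φ · a`, for `φ` with `⟨φ, φ⟩ = 1`. -/
noncomputable def unitMap (φ : X) (hφ : ⟪φ, φ⟫ = 1) : InnerMap (HilbertModule.self A) X where
  toFun := fun a : A => op a • φ
  map_add' := fun (a b : A) => by rw [← add_smul, ← op_add]; rfl
  map_smul' := fun b (a : A) => by rw [RingHom.id_apply, smul_smul]; rfl
  inner_map := fun (a b : A) => by
    rw [inner_op_smul_left, inner_op_smul_right, hφ, one_mul]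
    rfl

theorem unitMap_one {φ : X} (hφ : ⟪φ, φ⟫ = 1) : unitMap φ hφ (1 : A) = φ := one_smul _ φ

theorem isComplementedIn_range_unitMap {φ : X} (hφ : ⟪φ, φ⟫ = 1) {W : Submodule Aᵐᵒᵖ X}
    (hW : φ ∈ W) : IsComplementedIn (unitMap φ hφ).range W where
  isClosed := InnerMap.isClosed_range _
  le := by
    rintro _ ⟨a, rfl⟩
    exact W.smul_mem _ hW
  exists_add x hx := by
    refine ⟨op ⟪φ, x⟫ • φ, ⟨(⟪φ, x⟫ : A), rfl⟩, x - op ⟪φ, x⟫ • φ,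
      W.sub_mem hx (W.smul_mem _ hW), ?_, add_sub_cancel _ _⟩
    rintro _ ⟨a, rfl⟩
    change ⟪op (show A from a) • φ, _⟫ = 0
    rw [inner_op_smul_left, inner_sub_right, inner_op_smul_right, hφ, one_mul, sub_self, mul_zero]

end HilbertModule

namespace IsScalingFunction

open HilbertModule (unitMap unitMap_one)

variable {X : HilbertModule A} {M : Correspondence A} {D : HilbertModuleIso X (X.tensor M)}
  {m : M} {φ : X} (h : IsScalingFunction m X D φ)

/-- The map `M^{⊗k} → X`, `n ↦ (D^k)⁻¹(φ ⊗ n)`. Its range is the `k`-th multi-resolution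
space. -/
noncomputable def embed (k : ℕ) : InnerMap (M.pow k) X :=
  D.dilateMap (unitMap φ h.inner_self) k

theorem dilation_comp_embed_succ (k : ℕ) :
    D.toInnerMap.comp (h.embed (k + 1)) = (h.embed k).tensorId M :=
  D.dilation_comp_dilateMap_succ _ k

theorem range_embed (k : ℕ) :
    (h.embed k).range = D.dilate^[k] (unitMap φ h.inner_self).range :=
  D.range_dilateMap _ k

section Limit

variable (hM : M.IsEssential) (hm : M.IsFilter m)

theorem unitMap_tensorId_comp_shift_zero :
    ((unitMap φ h.inner_self).tensorId M).comp (Correspondence.shift hM hm 0) =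
      D.toInnerMap.comp (unitMap φ h.inner_self) :=
  DFunLike.ext _ _ fun (a : A) => by
    refine (InnerMap.tensorId_tmul _ _ _ _).trans ?_
    refine (congrArg (HilbertModule.tmul · _) (unitMap_one h.inner_self)).trans ?_
    refine Eq.trans ?_ (D.toLinearMap.map_smul (op a) φ).symm
    exact (HilbertModule.tmul_op_smul φ m (op a)).trans (congrArg (op a • ·) h.dilation.symm)

theorem embed_succ_comp_shift (k : ℕ) :
    (h.embed (k + 1)).comp (Correspondence.shift hM hm k) = h.embed k :=
  D.dilateMap_succ_comp (fun _ => rfl) (h.unitMap_tensorId_comp_shift_zero hM hm) k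

/-- The map `M_∞ → X` induced by the maps `M^{⊗k} → X`, `n ↦ (D^k)⁻¹(φ ⊗ n)`. -/
noncomputable def limitEmbed : InnerMap (Correspondence.limit hM hm) X :=
  HilbertModule.limitLift h.embed (h.embed_succ_comp_shift hM hm)

theorem limitEmbed_comp_ι (k : ℕ) :
    (h.limitEmbed hM hm).comp (Correspondence.ι hM hm k) = h.embed k :=
  HilbertModule.limitLift_comp_ι h.embed (h.embed_succ_comp_shift hM hm) k

theorem limitEmbed_ι_zero_one :
    h.limitEmbed hM hm (Correspondence.ι hM hm 0 M.one) = φ :=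
  (DFunLike.congr_fun (h.limitEmbed_comp_ι hM hm 0) M.one).trans
    (unitMap_one h.inner_self)

theorem dilation_comp_limitEmbed :
    D.toInnerMap.comp (h.limitEmbed hM hm) =
      ((h.limitEmbed hM hm).tensorId M).comp (Correspondence.limitDilation hM hm).toInnerMap := by
  have tensorId_comp_ι (k : ℕ) :
      ((h.limitEmbed hM hm).tensorId M).comp ((Correspondence.ι hM hm k).tensorId M) =
        (h.embed k).tensorId M := by
    rw [← InnerMap.tensorId_comp, limitEmbed_comp_ι]
  have comp_ι_succ (k : ℕ) :
      D.toInnerMap.comp ((h.limitEmbed hM hm).comp (Correspondence.ι hM hm (k + 1))) =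
        ((h.limitEmbed hM hm).tensorId M).comp
          ((Correspondence.limitDilation hM hm).toInnerMap.comp
            (Correspondence.ι hM hm (k + 1))) := by
    rw [limitEmbed_comp_ι, Correspondence.limitDilation_comp_ι]
    exact (h.dilation_comp_embed_succ k).trans (tensorId_comp_ι k).symm
  refine HilbertModule.limit_ext fun k => ?_
  rw [← HilbertModule.ι_comp]
  exact congrArg (InnerMap.comp · (Correspondence.shift hM hm k)) (comp_ι_succ k)

theorem isProjectiveMRA :
    IsProjectiveMRA D (h.limitEmbed hM hm).range fun k => (h.embed k).range := by
  have range_limitEmbed : (h.limitEmbed hM hm).range =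
      (⨆ k, D.dilate^[k] (unitMap φ h.inner_self).range).topologicalClosure := by
    simp only [← h.range_embed]
    exact HilbertModule.range_limitLift h.embed (h.embed_succ_comp_shift hM hm)
  simp only [range_limitEmbed, h.range_embed]
  refine D.isProjectiveMRA_dilate_iterate ?_
    (HilbertModule.isComplementedIn_range_unitMap h.inner_self ?_)
  · refine le_of_le_of_eq ?_ (h.range_embed 1)
    exact (congrArg InnerMap.range (h.embed_succ_comp_shift hM hm 0)).ge.trans
      (LinearMap.range_comp_le_range _ _)
  · rw [← range_limitEmbed]
    exact ⟨_, h.limitEmbed_ι_zero_one hM hm⟩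

end Limit

end IsScalingFunction

end

theorem mainTheorem4 {A : Type u} [CStarAlgebra A] [PartialOrder A] [StarOrderedRing A]
    (M : Correspondence A) (hM : M.IsEssential) (m : M) (hm : M.IsFilter m)
    (X : HilbertModule A) (D : HilbertModuleIso X (X.tensor M)) (φ : X)
    (hφ : IsScalingFunction m X D φ) :
    ∃ R : HilbertModuleIso (Correspondence.limit hM hm) ((Correspondence.limit hM hm).tensor M),
      (∀ k, R.toInnerMap.comp (Correspondence.ι hM hm (k + 1)) =
        (Correspondence.ι hM hm k).tensorId M) ∧
      ∃ Q : InnerMap (Correspondence.limit hM hm) X,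
        Q (Correspondence.ι hM hm 0 M.one) = φ ∧
        D.toInnerMap.comp Q = (Q.tensorId M).comp R.toInnerMap ∧
        ∃ V : ℕ → Submodule Aᵐᵒᵖ X,
          (∀ k, V k = LinearMap.range (Q.comp (Correspondence.ι hM hm k)).toLinearMap) ∧
          IsProjectiveMRA D (LinearMap.range Q.toLinearMap) V ∧
          (V 0 : Set X) = Set.range (fun a : A => MulOpposite.op a • φ) ∧
          Function.Injective (fun a : A => MulOpposite.op a • φ) :=
  ⟨Correspondence.limitDilation hM hm, Correspondence.limitDilation_comp_ι hM hm,
    hφ.limitEmbed hM hm, hφ.limitEmbed_ι_zero_one hM hm, hφ.dilation_comp_limitEmbed hM hm,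
    fun k => (hφ.embed k).range, fun k => by rw [hφ.limitEmbed_comp_ι],
    hφ.isProjectiveMRA hM hm, rfl, (HilbertModule.unitMap φ hφ.inner_self).injective⟩
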